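/- Fix $\lambda\in(0,\infty)$, $D\in(0,1/2]$ and a probability measure $\nu$ on $(0,\infty)$; write $\sigma$ for a random variable with law $\nu$. On a probability space, let $W=(W_t)_{t\ge 0}$ be a standard Brownian motion, let $\mathcal T=(\tau_n)_{n\in\mathbb Z}$ be a Poisson point process on $\mathbb R$ with intensity $\lambda$, whose points are labelled increasingly with $\tau_0<0<\tau_1$, and let $(\sigma_n)_{n\ge 0}$ be i.i.d. random variables with law $\nu$; assume that $W$, $\mathcal T$ and $(\sigma_n)_{n\ge 0}$ are independent. For $t\ge 0$ set $i(t):=\sup\{n\ge 0:\tau_n\le t\}$, $$I_t:=\sigma_{i(t)}^2\,(t-\tau_{i(t)})^{2D}+\sum_{k=1}^{i(t)}\sigma_{k-1}^2\,(\tau_k-\tau_{k-1})^{2D}-\sigma_0^2\,(-\tau_0)^{2D},\qquad X_t:=W_{I_t}.$$ Assume that $E(\sigma^2)<\infty$. For $x\ge 0$ let $$\phi(x):=\mathrm{Cov}\big(\sigma S^{D-1/2},\ \sigma (S+x)^{D-1/2}\big),$$ where $S\sim \mathrm{Exp}(1)$ is independent of $\sigma\sim\nu$. Then the increments $X_t-X_s$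 ($s,t\ge 0$) and the variables $\sigma (S+x)^{D-1/2}$ ($x\ge 0$) are square integrable, and for all $s,t>0$ with $s\ne t$, as $h\downarrow 0$, $$\mathrm{Cov}\big(|X_{s+h}-X_s|,\,|X_{t+h}-X_t|\big)=\frac{4D}{\pi}\,\lambda^{1-2D}\,e^{-\lambda|t-s|}\,\big(\phi(\lambda|t-s|)\,h+o(h)\big).$$ -/

import Mathlib

open MeasureTheory ProbabilityTheory Filter Topology Asymptotics
open scoped NNReal ENNReal

noncomputable section

namespace VolModel

variable {Ω : Type*} [MeasurableSpace Ω]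

/-- The (possibly infinite) number of points of the sequence `τ` that lie in `A`. -/
def pointCount (τ : ℤ → Ω → ℝ) (A : Set ℝ) (ω : Ω) : ℕ∞ :=
  Set.encard {n : ℤ | τ n ω ∈ A}

/-- `τ` enumerates, in increasing order and with the labelling `τ 0 < 0 < τ 1`, the points of a
(homogeneous) Poisson point process on the whole real line with intensity `lam`: the number of
points in a Borel set of finite length `ℓ` has the Poisson law of parameter `lam * ℓ`, and the
numbers of points in pairwise disjoint Borel sets are independent. -/
structure IsPoissonPointProcess (τ : ℤ → Ω → ℝ) (lam : ℝ) (P : Measure Ω) : Prop where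
  measurable : ∀ n, Measurable (τ n)
  strictMono : ∀ᵐ ω ∂P, StrictMono fun n => τ n ω
  label : ∀ᵐ ω ∂P, τ 0 ω < 0 ∧ 0 < τ 1 ω
  law_count : ∀ A : Set ℝ, MeasurableSet A → volume A ≠ ∞ →
    HasLaw (pointCount τ A)
      ((poissonMeasure (lam * volume.real A).toNNReal).map (Nat.cast : ℕ → ℕ∞)) P
  indep_count : ∀ (k : ℕ) (A : Fin k → Set ℝ), (∀ j, MeasurableSet (A j)) →
    Pairwise (fun j l => Disjoint (A j) (A l)) →
    iIndepFun (fun j => pointCount τ (A j)) P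

/-- The three sources of randomness of the model: a standard Brownian motion `W`, a Poisson point
process `τ` on the line with intensity `lam`, and an i.i.d. sequence `σ` with law `ν`; the three
are (mutually) independent. -/
structure IsNoise (lam : ℝ) (ν : Measure ℝ) (W : ℝ≥0 → Ω → ℝ) (τ : ℤ → Ω → ℝ)
    (σ : ℕ → Ω → ℝ) (P : Measure Ω) : Prop where
  measurable_W : ∀ u, Measurable (W u)
  brownian : IsBrownianReal W P
  poisson : IsPoissonPointProcess τ lam P
  measurable_σ : ∀ n, Measurable (σ n)
  law_σ : ∀ n, HasLaw (σ n) ν P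
  iIndep_σ : iIndepFun σ P
  indep_τ_σ : IndepFun (fun ω n => τ n ω) (fun ω n => σ n ω) P
  indep_W : IndepFun (fun ω u => W u ω)
    (fun ω => ((fun n => τ n ω : ℤ → ℝ), (fun n => σ n ω : ℕ → ℝ))) P

/-- `i(t) = sup {n ≥ 0 : τ n ≤ t}`, so that `τ (i t)` is the last point before `t ≥ 0`. -/
def lastIndex (τ : ℤ → Ω → ℝ) (t : ℝ) (ω : Ω) : ℕ :=
  sSup {n : ℕ | τ n ω ≤ t}

/-- The time change
`I t = σ_{i(t)}² (t - τ_{i(t)})^{2D} + ∑_{k=1}^{i(t)} σ_{k-1}² (τ_k - τ_{k-1})^{2D}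
  - σ_0² (-τ_0)^{2D}`. -/
def timeChange (D : ℝ) (τ : ℤ → Ω → ℝ) (σ : ℕ → Ω → ℝ) (t : ℝ) (ω : Ω) : ℝ :=
  σ (lastIndex τ t ω) ω ^ 2 * (t - τ (lastIndex τ t ω) ω) ^ (2 * D)
    + ∑ k ∈ Finset.Icc 1 (lastIndex τ t ω),
        σ (k - 1) ω ^ 2 * (τ k ω - τ ((k : ℤ) - 1) ω) ^ (2 * D)
    - σ 0 ω ^ 2 * (-τ 0 ω) ^ (2 * D)

/-- The process `X t = W_{I t}`, for `t ≥ 0` (where `I t ≥ 0` almost surely). -/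
def process (D : ℝ) (W : ℝ≥0 → Ω → ℝ) (τ : ℤ → Ω → ℝ) (σ : ℕ → Ω → ℝ) (t : ℝ) (ω : Ω) : ℝ :=
  W (timeChange D τ σ t ω).toNNReal ω

/-- `φ(x) = Cov(σ S^{D-1/2}, σ (S+x)^{D-1/2})` with `(σ, S)` distributed as `ν ⊗ Exp(1)`. -/
def phi (D : ℝ) (ν : Measure ℝ) (x : ℝ) : ℝ :=
  covariance (fun p : ℝ × ℝ => p.1 * p.2 ^ (D - 1 / 2))
    (fun p : ℝ × ℝ => p.1 * (p.2 + x) ^ (D - 1 / 2)) (ν.prod (expMeasure 1))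

end VolModel

end

/-! Given `τ` and `σ`, the time change is deterministic and increasing, so the increments of `X`
over disjoint intervals are independent centred Gaussians whose variances are the increments of `I`.
Since `E|N(0,v)| = √(2v/π)`, for `h ≤ |t - s|` the covariance is `2/π` times the covariance of
`√(I_{s+h} - I_s)` and `√(I_{t+h} - I_t)` (`covariance_abs_sub_div`).

After division by `h`, the square roots converge almost surely to `√I'_s` and `√I'_t`. The age, i.e.
the time elapsed since the last point, is exponential with parameter `λ` at every time, so
`E[(I_{t+h} - I_t)/h] = E[I'_t]` for all `h > 0`. The bounds `√x ≤ 1 + x` and `√x √y ≤ x + y`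
therefore have constant expectations, and dominated convergence with converging bounds passes to the
limit.

It remains to compute the covariance of the volatilities `V_r = σ_{i(r)} (λ · age_r)^{D-1/2}` for `s
< t`; put `x = λ(t - s)` (`exists_lintegral_volatility_mul`). With probability `e^{-x}` there is no
point in `(s, t]`: then the marks agree and `λ · age_t = λ · age_s + x`. Otherwise the marks are
independent, and `age_t` on this event is independent of `age_s`. Splitting the mean of `V_t` in the
same way makes the second contribution cancel in the covariance, which leaves `e^{-x} φ(x)`. -/

noncomputable section

/-! ### The time change of a fixed configuration as the integral of its rate -/

namespace VolModel

/-- The configurations of points that are labelled as in the model and have no accumulation point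
on the right. -/
structure IsRegular (x : ℤ → ℝ) : Prop where
  strictMono : StrictMono x
  zero_neg : x 0 < 0
  one_pos : 0 < x 1
  exists_lt : ∀ t : ℝ, ∃ n : ℕ, t < x n

/-- The index of the last point before `t` of a fixed configuration. -/
def lastIdx (x : ℤ → ℝ) (t : ℝ) : ℕ := sSup {n : ℕ | x n ≤ t}

/-- The time elapsed at `t` since the last point before `t`. -/
def age (x : ℤ → ℝ) (t : ℝ) : ℝ := t - x (lastIdx x t)

/-- The time change as a function of the paths of `τ` and `σ`, with index `n` in place of `i(t)`. -/
def clockAt (D : ℝ) (x : ℤ → ℝ) (y : ℕ → ℝ) (n : ℕ) (t : ℝ) : ℝ :=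
  y n ^ 2 * (t - x n) ^ (2 * D)
    + ∑ k ∈ Finset.Icc 1 n, y (k - 1) ^ 2 * (x k - x ((k : ℤ) - 1)) ^ (2 * D)
    - y 0 ^ 2 * (-x 0) ^ (2 * D)

/-- The time change as a function of the paths of `τ` and `σ`. -/
def clock (D : ℝ) (x : ℤ → ℝ) (y : ℕ → ℝ) (t : ℝ) : ℝ := clockAt D x y (lastIdx x t) t

/-- The derivative of the time change. -/
def clockRate (D : ℝ) (x : ℤ → ℝ) (y : ℕ → ℝ) (t : ℝ) : ℝ :=
  y (lastIdx x t) ^ 2 * (2 * D * age x t ^ (2 * D - 1))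

namespace IsRegular

variable {x : ℤ → ℝ} (hx : IsRegular x)
include hx

lemma bddAbove (t : ℝ) : BddAbove {n : ℕ | x n ≤ t} := by
  obtain ⟨m, hm⟩ := hx.exists_lt t
  refine ⟨m, fun n hn => ?_⟩
  by_contra! h
  have := hx.strictMono.monotone (show (m : ℤ) ≤ n by exact_mod_cast h.le)
  simp only [Set.mem_ofPred_eq] at hn
  linarith

lemma apply_lastIdx_le {t : ℝ} (ht : 0 ≤ t) : x (lastIdx x t) ≤ t :=
  Nat.sSup_mem (s := {n : ℕ | x n ≤ t})
    ⟨0, by simpa using hx.zero_neg.le.trans ht⟩ (hx.bddAbove t)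

lemma lt_apply_lastIdx_succ (t : ℝ) : t < x (lastIdx x t + 1) := by
  by_contra! h
  have : lastIdx x t + 1 ≤ lastIdx x t := le_csSup (hx.bddAbove t) (by simpa using h)
  omega

lemma lastIdx_eq {n : ℕ} {t : ℝ} (h₁ : x n ≤ t) (h₂ : t < x (n + 1)) : lastIdx x t = n := by
  apply le_antisymm
  · refine csSup_le ⟨n, h₁⟩ fun m hm => ?_
    by_contra! h
    have := hx.strictMono.monotone (show (n : ℤ) + 1 ≤ m by exact_mod_cast h)
    simp only [Set.mem_ofPred_eq] at hm
    linarith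
  · exact le_csSup (hx.bddAbove t) h₁

lemma age_nonneg {t : ℝ} (ht : 0 ≤ t) : 0 ≤ age x t := sub_nonneg.2 (hx.apply_lastIdx_le ht)

/-- Turns events about the age into void events of the point process, whose probabilities are known.
For `u < 0` the interval is empty and both sides hold. -/
lemma lt_age_iff {t u : ℝ} (ht : 0 ≤ t) : u < age x t ↔ ∀ n : ℤ, x n ∉ Set.Icc (t - u) t := by
  constructor
  · intro h n hn
    have h1 : n < (lastIdx x t : ℤ) + 1 :=
      hx.strictMono.lt_iff_lt.1 (hn.2.trans_lt (hx.lt_apply_lastIdx_succ t))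
    have h2 := hx.strictMono.monotone (show n ≤ lastIdx x t by omega)
    have h3 := hn.1
    unfold age at h
    linarith
  · intro h
    have h1 := h (lastIdx x t)
    have h2 := hx.apply_lastIdx_le ht
    simp only [Set.mem_Icc, not_and', not_le] at h1
    have := h1 h2
    unfold age
    linarith

lemma lastIdx_eq_of_le_age {s t : ℝ} (hst : s ≤ t) (h : t - s ≤ age x t) :
    lastIdx x t = lastIdx x s := by
  symm
  apply hx.lastIdx_eq
  · unfold age at h
    linarith
  · exact hst.trans_lt (hx.lt_apply_lastIdx_succ t)

lemma lastIdx_ne_of_age_lt {s t : ℝ} (hs : 0 ≤ s) (h : age x t < t - s) :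
    lastIdx x t ≠ lastIdx x s := by
  intro he
  have := hx.apply_lastIdx_le hs
  unfold age at h
  rw [he] at h
  linarith

end IsRegular

/-- The exponent exceeds `-1`, so the singularity at `c` is integrable and `a = c` is allowed. -/
lemma lintegral_rpow_sub {D c a b : ℝ} (hD : 0 < D) (hca : c ≤ a) (hab : a ≤ b) :
    ∫⁻ r in Set.Ioc a b, ENNReal.ofReal (2 * D * (r - c) ^ (2 * D - 1))
      = ENNReal.ofReal ((b - c) ^ (2 * D) - (a - c) ^ (2 * D)) := by
  have hi : IntervalIntegrable (fun r : ℝ => (r - c) ^ (2 * D - 1)) volume a b := by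
    have := (intervalIntegral.intervalIntegrable_rpow' (a := a - c) (b := b - c)
      (r := 2 * D - 1) (by linarith)).comp_sub_right c
    simpa using this
  have h1 : ∫ r in a..b, 2 * D * (r - c) ^ (2 * D - 1)
      = (b - c) ^ (2 * D) - (a - c) ^ (2 * D) := by
    rw [intervalIntegral.integral_const_mul,
      intervalIntegral.integral_comp_sub_right (fun r : ℝ => r ^ (2 * D - 1)) c,
      integral_rpow (Or.inl (by linarith))]
    simp only [sub_add_cancel]
    field_simp
  rw [← h1, intervalIntegral.integral_of_le hab, ofReal_integral_eq_lintegral_ofReal]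
  · exact ((hi.const_mul (2 * D)).1)
  · filter_upwards [self_mem_ae_restrict measurableSet_Ioc] with r hr
    have : 0 ≤ r - c := by linarith [hr.1]
    positivity

lemma lintegral_clockRate_piece {D : ℝ} (hD : 0 < D) {x : ℤ → ℝ} (hx : IsRegular x)
    (y : ℕ → ℝ) (n : ℕ) {a b : ℝ} (ha : x n ≤ a) (hab : a ≤ b) (hb : b ≤ x (n + 1)) :
    ∫⁻ r in Set.Ioc a b, ENNReal.ofReal (clockRate D x y r)
      = ENNReal.ofReal (y n ^ 2 * ((b - x n) ^ (2 * D) - (a - x n) ^ (2 * D))) := by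
  have hpos : (0 : ℝ) ≤ y n ^ 2 := sq_nonneg _
  rw [ENNReal.ofReal_mul hpos, ← lintegral_rpow_sub hD ha hab,
    ← lintegral_const_mul' _ _ ENNReal.ofReal_ne_top]
  -- The right endpoint may be the next point, where the index jumps; it is a null set.
  rw [← restrict_Ioo_eq_restrict_Ioc]
  refine setLIntegral_congr_fun measurableSet_Ioo fun r hr => ?_
  have hl : lastIdx x r = n := hx.lastIdx_eq (ha.trans hr.1.le) (hr.2.trans_le hb)
  simp only [clockRate, age, hl, ENNReal.ofReal_mul hpos]

lemma clockAt_succ (D : ℝ) (x : ℤ → ℝ) (y : ℕ → ℝ) (n : ℕ) (t : ℝ) :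
    clockAt D x y (n + 1) t
      = clockAt D x y n (x (n + 1)) + y (n + 1) ^ 2 * (t - x (n + 1)) ^ (2 * D) := by
  unfold clockAt
  rw [Finset.sum_Icc_succ_top (by omega)]
  simp
  ring

/-- Induction over the pieces between consecutive points. The endpoint `x (n + 1)` is included so
that the next piece can start there, and nonnegativity is carried along because `ENNReal.ofReal` is
additive only on nonnegative numbers. In the base case the subtracted term makes the clock vanish at
time `0`. -/
lemma lintegral_clockRate_eq_clockAt {D : ℝ} (hD : 0 < D) {x : ℤ → ℝ} (hx : IsRegular x)
    (y : ℕ → ℝ) (n : ℕ) : ∀ t, 0 ≤ t → x n ≤ t → t ≤ x (n + 1) →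
      0 ≤ clockAt D x y n t ∧ ∫⁻ r in Set.Ioc 0 t, ENNReal.ofReal (clockRate D x y r)
        = ENNReal.ofReal (clockAt D x y n t) := by
  induction n with
  | zero =>
    intro t ht h0 h1
    have he : clockAt D x y 0 t = y 0 ^ 2 * ((t - x 0) ^ (2 * D) - (0 - x 0) ^ (2 * D)) := by
      simp [clockAt]; ring
    constructor
    · rw [he]
      refine mul_nonneg (sq_nonneg _) (sub_nonneg.2 ?_)
      have := hx.zero_neg
      exact Real.rpow_le_rpow (by linarith) (by linarith) (by linarith)
    · rw [he]
      exact_mod_cast lintegral_clockRate_piece hD hx y 0 (by simpa using hx.zero_neg.le) ht h1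
  | succ n ih =>
    intro t ht h0 h1
    push_cast at h0 h1
    have hn : 0 ≤ x (n + 1) := hx.one_pos.le.trans (hx.strictMono.monotone (by omega))
    obtain ⟨i1, i2⟩ := ih (x (n + 1)) hn (hx.strictMono.monotone (by omega)) le_rfl
    have hnn : 0 ≤ y (n + 1) ^ 2 * (t - x (n + 1)) ^ (2 * D) :=
      mul_nonneg (sq_nonneg _) (Real.rpow_nonneg (by linarith) _)
    rw [clockAt_succ]
    refine ⟨add_nonneg i1 hnn, ?_⟩
    rw [← Set.Ioc_union_Ioc_eq_Ioc hn h0, lintegral_union measurableSet_Ioc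
      (Set.Ioc_disjoint_Ioc_of_le le_rfl), i2, ENNReal.ofReal_add i1 hnn]
    congr 1
    have := lintegral_clockRate_piece hD hx y (n + 1) (a := x (n + 1)) (b := t)
      (by push_cast; exact le_rfl) h0 (by push_cast; exact h1)
    rw [this]
    push_cast
    simp [hD.ne']

section

variable {D : ℝ} (hD : 0 < D) {x : ℤ → ℝ} (hx : IsRegular x) (y : ℕ → ℝ)
include hD hx

lemma clock_nonneg {t : ℝ} (ht : 0 ≤ t) : 0 ≤ clock D x y t :=
  (lintegral_clockRate_eq_clockAt hD hx y _ t ht (hx.apply_lastIdx_le ht)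
    (hx.lt_apply_lastIdx_succ t).le).1

lemma lintegral_clockRate {t : ℝ} (ht : 0 ≤ t) :
    ∫⁻ r in Set.Ioc 0 t, ENNReal.ofReal (clockRate D x y r) = ENNReal.ofReal (clock D x y t) :=
  (lintegral_clockRate_eq_clockAt hD hx y _ t ht (hx.apply_lastIdx_le ht)
    (hx.lt_apply_lastIdx_succ t).le).2

lemma clock_mono {s t : ℝ} (hs : 0 ≤ s) (hst : s ≤ t) : clock D x y s ≤ clock D x y t := by
  rw [← ENNReal.ofReal_le_ofReal_iff (clock_nonneg hD hx y (hs.trans hst)),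
    ← lintegral_clockRate hD hx y hs, ← lintegral_clockRate hD hx y (hs.trans hst)]
  exact lintegral_mono_set (Set.Ioc_subset_Ioc_right hst)

lemma lintegral_clockRate_Ioc {s t : ℝ} (hs : 0 ≤ s) (hst : s ≤ t) :
    ∫⁻ r in Set.Ioc s t, ENNReal.ofReal (clockRate D x y r)
      = ENNReal.ofReal (clock D x y t - clock D x y s) := by
  have h := lintegral_clockRate hD hx y (hs.trans hst)
  rw [← Set.Ioc_union_Ioc_eq_Ioc hs hst, lintegral_union measurableSet_Ioc
    (Set.Ioc_disjoint_Ioc_of_le le_rfl), lintegral_clockRate hD hx y hs] at h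
  rw [ENNReal.ofReal_sub _ (clock_nonneg hD hx y hs), ← h,
    ENNReal.add_sub_cancel_left ENNReal.ofReal_ne_top]

-- A positive age keeps `s` away from the points, where the power need not be differentiable; the
-- index stays constant on a right neighbourhood of `s`.
omit hD in
lemma tendsto_clock_slope {s : ℝ} (hs : 0 ≤ s) (hage : 0 < age x s) :
    Tendsto (fun h => (clock D x y (s + h) - clock D x y s) / h) (𝓝[>] 0)
      (𝓝 (clockRate D x y s)) := by
  set n := lastIdx x s with hn
  have hd : HasDerivAt (fun r => clockAt D x y n r) (clockRate D x y s) s := by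
    have h1 : HasDerivAt (fun r : ℝ => (r - x n) ^ (2 * D))
        (1 * (2 * D) * (s - x n) ^ (2 * D - 1)) s :=
      ((hasDerivAt_id s).sub_const (x n)).rpow_const (Or.inl hage.ne')
    have h2 := ((h1.const_mul (y n ^ 2)).add_const
      (∑ k ∈ Finset.Icc 1 n, y (k - 1) ^ 2 * (x k - x ((k : ℤ) - 1)) ^ (2 * D))).sub_const
        (y 0 ^ 2 * (-x 0) ^ (2 * D))
    rw [one_mul] at h2
    exact h2
  have h3 := hd.tendsto_slope_zero_right
  refine h3.congr' ?_
  have hlt : s < x (n + 1) := hx.lt_apply_lastIdx_succ s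
  filter_upwards [Ioo_mem_nhdsGT (sub_pos.2 hlt)] with h hh
  have he : lastIdx x (s + h) = n :=
    hx.lastIdx_eq ((hx.apply_lastIdx_le hs).trans (by linarith [hh.1])) (by linarith [hh.2])
  simp only [clock, he, ← hn, smul_eq_mul]
  ring

end

/-! ### Joint measurability of the index, the age, the clock and its rate -/

lemma measurable_lastIdx : Measurable fun p : (ℤ → ℝ) × ℝ => lastIdx p.1 p.2 := by
  have hle : ∀ n : ℕ, MeasurableSet {p : (ℤ → ℝ) × ℝ | p.1 n ≤ p.2} := fun n =>
    measurableSet_le (by fun_prop) (by fun_prop)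
  -- The supremum has the default value `0` on empty and on unbounded sets, so only the fibres over
  -- successors are described directly; the fibre over `0` is the complement of their union.
  have hsucc : ∀ k : ℕ, MeasurableSet
      ((fun p : (ℤ → ℝ) × ℝ => lastIdx p.1 p.2) ⁻¹' {k + 1}) := by
    intro k
    have : (fun p : (ℤ → ℝ) × ℝ => lastIdx p.1 p.2) ⁻¹' {k + 1}
        = {p | p.1 ((k + 1 : ℕ) : ℤ) ≤ p.2} ∩
          ⋂ m : ℕ, {p | k + 1 < m → ¬ p.1 m ≤ p.2} := by
      ext p
      simp only [Set.mem_preimage, Set.mem_singleton_iff, Set.mem_inter_iff, Set.mem_ofPred_eq,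
        Set.mem_iInter]
      constructor
      · intro h
        have hb : BddAbove {n : ℕ | p.1 n ≤ p.2} := by
          by_contra hb
          rw [lastIdx, Nat.sSup_of_not_bddAbove hb] at h
          omega
        have hne : {n : ℕ | p.1 n ≤ p.2}.Nonempty := by
          by_contra hne
          rw [lastIdx, Set.not_nonempty_iff_eq_empty.1 hne] at h
          simp at h
        refine ⟨?_, fun m hm hm' => ?_⟩
        · have := Nat.sSup_mem hne hb
          rw [show sSup _ = k + 1 from h] at this
          exact this
        · have := le_csSup hb (show m ∈ {n : ℕ | p.1 n ≤ p.2} from hm')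
          rw [show sSup _ = k + 1 from h] at this
          omega
      · rintro ⟨h1, h2⟩
        have hub : ∀ m ∈ {n : ℕ | p.1 n ≤ p.2}, m ≤ k + 1 := fun m hm => by
          by_contra! hlt
          exact h2 m hlt hm
        exact le_antisymm (csSup_le ⟨k + 1, h1⟩ hub) (le_csSup ⟨k + 1, hub⟩ h1)
    rw [this]
    refine (hle _).inter (MeasurableSet.iInter fun m => ?_)
    by_cases hm : k + 1 < m
    · simp only [hm, true_imp_iff]
      exact (hle m).compl
    · simp only [hm, false_imp_iff, Set.ofPred_true, MeasurableSet.univ]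
  refine measurable_to_countable' fun k => ?_
  cases k with
  | succ k => exact hsucc k
  | zero =>
    have : (fun p : (ℤ → ℝ) × ℝ => lastIdx p.1 p.2) ⁻¹' {0}
        = (⋃ k : ℕ, (fun p : (ℤ → ℝ) × ℝ => lastIdx p.1 p.2) ⁻¹' {k + 1})ᶜ := by
      ext p
      simp only [Set.mem_preimage, Set.mem_singleton_iff, Set.mem_compl_iff, Set.mem_iUnion,
        not_exists]
      constructor
      · intro h k
        omega
      · intro h
        by_contra h0
        exact h (lastIdx p.1 p.2 - 1) (by omega)
    rw [this]
    exact (MeasurableSet.iUnion hsucc).compl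

lemma measurable_apply_nat {α β : Type*} [MeasurableSpace α] [MeasurableSpace β] {n : α → ℕ}
    {f : ℕ → α → β} (hn : Measurable n) (hf : ∀ k, Measurable (f k)) :
    Measurable fun a => f (n a) a :=
  (measurable_from_prod_countable_right (f := fun p : ℕ × α => f p.1 p.2) hf).comp
    (hn.prodMk measurable_id)

lemma measurable_age : Measurable fun p : (ℤ → ℝ) × ℝ => age p.1 p.2 :=
  measurable_apply_nat (f := fun k (p : (ℤ → ℝ) × ℝ) => p.2 - p.1 k) measurable_lastIdx
    fun k => by fun_prop

lemma measurable_lastIdx_left (t : ℝ) : Measurable fun x : ℤ → ℝ => lastIdx x t :=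
  measurable_lastIdx.comp (measurable_id.prodMk measurable_const)

lemma measurable_age_left (t : ℝ) : Measurable fun x : ℤ → ℝ => age x t :=
  measurable_age.comp (measurable_id.prodMk measurable_const)

lemma measurable_clock (D t : ℝ) :
    Measurable fun p : (ℤ → ℝ) × (ℕ → ℝ) => clock D p.1 p.2 t := by
  refine measurable_apply_nat (f := fun k (p : (ℤ → ℝ) × (ℕ → ℝ)) => clockAt D p.1 p.2 k t)
    ((measurable_lastIdx_left t).comp measurable_fst) fun k => ?_
  unfold clockAt
  fun_prop

lemma measurable_clockRate (D : ℝ) :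
    Measurable fun p : ((ℤ → ℝ) × (ℕ → ℝ)) × ℝ => clockRate D p.1.1 p.1.2 p.2 := by
  unfold clockRate
  have h1 : Measurable fun p : ((ℤ → ℝ) × (ℕ → ℝ)) × ℝ => lastIdx p.1.1 p.2 :=
    measurable_lastIdx.comp ((measurable_fst.comp measurable_fst).prodMk measurable_snd)
  have h2 : Measurable fun p : ((ℤ → ℝ) × (ℕ → ℝ)) × ℝ => age p.1.1 p.2 :=
    measurable_age.comp ((measurable_fst.comp measurable_fst).prodMk measurable_snd)
  have h3 : Measurable fun p : ((ℤ → ℝ) × (ℕ → ℝ)) × ℝ => p.1.2 (lastIdx p.1.1 p.2) :=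
    measurable_apply_nat (f := fun k (p : ((ℤ → ℝ) × (ℕ → ℝ)) × ℝ) => p.1.2 k) h1
      fun k => by fun_prop
  fun_prop

end VolModel

end

/-! ### Brownian motion at independent random times, and a dominated convergence theorem -/

noncomputable section

namespace VolModel

variable {Ω : Type*} [MeasurableSpace Ω]

/-- Tonelli for the product law: `Y` is frozen at `ω` while `X` is averaged over an independent copy
`ω'`. This plays the role of conditioning on `Y`. -/
lemma lintegral_comp_of_indepFun {α β : Type*} [MeasurableSpace α] [MeasurableSpace β]
    {P : Measure Ω} [IsProbabilityMeasure P] {X : Ω → α} {Y : Ω → β}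
    (hX : Measurable X) (hY : Measurable Y) (h : IndepFun X Y P) {F : α × β → ℝ≥0∞}
    (hF : Measurable F) :
    ∫⁻ ω, F (X ω, Y ω) ∂P = ∫⁻ ω, ∫⁻ ω', F (X ω', Y ω) ∂P ∂P := by
  have : IsProbabilityMeasure (P.map X) := Measure.isProbabilityMeasure_map hX.aemeasurable
  have : IsProbabilityMeasure (P.map Y) := Measure.isProbabilityMeasure_map hY.aemeasurable
  have h1 := (indepFun_iff_map_prod_eq_prod_map_map hX.aemeasurable hY.aemeasurable).1 h
  rw [← lintegral_map (μ := P) hF (hX.prodMk hY), h1, lintegral_prod_symm _ hF.aemeasurable,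
    lintegral_map hF.lintegral_prod_left' hY]
  refine lintegral_congr fun ω => ?_
  exact lintegral_map (f := fun x => F (x, Y ω)) (hF.comp (by fun_prop)) hX

/-- Evaluation of a path at a time is jointly measurable on the continuous paths. -/
lemma exists_measurable_eval : ∃ L : (ℝ≥0 → ℝ) × ℝ≥0 → ℝ, Measurable L ∧
    ∀ w : ℝ≥0 → ℝ, Continuous w → ∀ u, L (w, u) = w u := by
  -- Only countably many times `k / n` are used, so each approximation is measurable for the product
  -- σ-algebra; `⌈u n⌉ / n → u` and continuity give the value at `u`.
  refine ⟨fun p => limUnder atTop fun n : ℕ => p.1 ((⌈p.2 * n⌉₊ : ℝ≥0) / n), ?_, ?_⟩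
  · refine (StronglyMeasurable.limUnder (l := atTop)
      (f := fun (n : ℕ) (p : (ℝ≥0 → ℝ) × ℝ≥0) => p.1 ((⌈p.2 * n⌉₊ : ℝ≥0) / n))
      fun n => ?_).measurable
    refine (measurable_apply_nat (n := fun p : (ℝ≥0 → ℝ) × ℝ≥0 => ⌈p.2 * n⌉₊)
      (f := fun k (p : (ℝ≥0 → ℝ) × ℝ≥0) => p.1 ((k : ℝ≥0) / n)) ?_ fun k => ?_).stronglyMeasurable
    · exact Nat.measurable_ceil.comp (by fun_prop)
    · exact (measurable_pi_apply _).comp measurable_fst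
  · intro w hw u
    refine Tendsto.limUnder_eq ((hw.tendsto u).comp ?_)
    rw [← NNReal.tendsto_coe]
    refine ((tendsto_nat_ceil_mul_div_atTop u.2).comp tendsto_natCast_atTop_atTop).congr
      fun n => ?_
    simp only [Function.comp_apply, NNReal.coe_div, NNReal.coe_natCast]
    congr 2

section

variable {E ι : Type*} [MeasurableSpace E] {P : Measure Ω}
  {W : ℝ≥0 → Ω → ℝ} (hWm : ∀ u, Measurable (W u)) (hWc : ∀ᵐ ω ∂P, Continuous (W · ω))
  {η : Ω → E} (hη : Measurable η)
include hWm hWc hη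

lemma aemeasurable_apply_randomTime {T : E → ℝ≥0} (hT : Measurable T) :
    AEMeasurable (fun ω => W (T (η ω)) ω) P := by
  obtain ⟨L, hL, hLc⟩ := exists_measurable_eval
  refine ⟨fun ω => L (fun u => W u ω, T (η ω)), ?_, ?_⟩
  · exact hL.comp ((measurable_pi_iff.2 hWm).prodMk (hT.comp hη))
  · filter_upwards [hWc] with ω hω using (hLc _ hω _).symm

lemma lintegral_apply_randomTimes [IsProbabilityMeasure P]
    (hind : IndepFun (fun ω u => W u ω) η P)
    {T : ι → E → ℝ≥0} (hT : ∀ i, Measurable (T i)) {G : (ι → ℝ) → ℝ≥0∞} (hG : Measurable G) :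
    ∫⁻ ω, G (fun i => W (T i (η ω)) ω) ∂P
      = ∫⁻ ω, ∫⁻ ω', G (fun i => W (T i (η ω)) ω') ∂P ∂P := by
  obtain ⟨L, hL, hLc⟩ := exists_measurable_eval
  have hF : Measurable fun p : (ℝ≥0 → ℝ) × E => G (fun i => L (p.1, T i p.2)) :=
    hG.comp (measurable_pi_iff.2 fun i =>
      hL.comp (measurable_fst.prodMk ((hT i).comp measurable_snd)))
  have h := lintegral_comp_of_indepFun (measurable_pi_iff.2 hWm) hη hind hF
  have h1 : ∫⁻ ω, G (fun i => W (T i (η ω)) ω) ∂P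
      = ∫⁻ ω, G (fun i => L (fun u => W u ω, T i (η ω))) ∂P := by
    refine lintegral_congr_ae ?_
    filter_upwards [hWc] with ω hω
    simp only [hLc _ hω]
  rw [h1, h]
  refine lintegral_congr fun ω => lintegral_congr_ae ?_
  filter_upwards [hWc] with ω' hω'
  simp only [hLc _ hω']

end

lemma integral_abs_gaussianReal (v : ℝ≥0) :
    ∫ x, |x| ∂(gaussianReal 0 v) = √(2 / Real.pi) * √v := by
  rcases eq_or_ne v 0 with rfl | hv
  · simp
  have hv' : (0 : ℝ) < v := by positivity
  rw [integral_gaussianReal_eq_integral_smul hv]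
  have h1 : ∀ x : ℝ, gaussianPDFReal 0 v x • |x|
      = (fun y : ℝ => (√(2 * Real.pi * v))⁻¹ * (y ^ (1 : ℝ) *
        Real.exp (-(2 * (v : ℝ))⁻¹ * y ^ (2 : ℝ)))) |x| := by
    intro x
    simp only [gaussianPDFReal, smul_eq_mul, sub_zero, Real.rpow_one, Real.rpow_ofNat, sq_abs]
    rw [show -x ^ 2 / (2 * (v : ℝ)) = -(2 * (v : ℝ))⁻¹ * x ^ 2 by ring]
    ring
  simp_rw [h1]
  rw [integral_comp_abs (f := fun y : ℝ => (√(2 * Real.pi * v))⁻¹ * (y ^ (1 : ℝ) *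
        Real.exp (-(2 * (v : ℝ))⁻¹ * y ^ (2 : ℝ)))), integral_const_mul,
    integral_rpow_mul_exp_neg_mul_rpow (by norm_num) (by norm_num) (by positivity)]
  norm_num
  rw [Real.rpow_neg_one]
  have hs : √Real.pi * √Real.pi = Real.pi := Real.mul_self_sqrt Real.pi_pos.le
  have h2 : √(2 : ℝ) * √2 = 2 := Real.mul_self_sqrt (by norm_num)
  have h3 : √(v : ℝ) * √v = v := Real.mul_self_sqrt hv'.le
  have p1 : 0 < √Real.pi := Real.sqrt_pos.2 Real.pi_pos
  have p2 : 0 < √(v : ℝ) := Real.sqrt_pos.2 hv'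
  field_simp
  nlinarith

section

variable {P : Measure Ω} {W : ℝ≥0 → Ω → ℝ} (hW : IsPreBrownianReal W P)
include hW

lemma lintegral_enorm_increment {a b : ℝ≥0} (hab : a ≤ b) :
    ∫⁻ ω, ‖W b ω - W a ω‖ₑ ∂P
      = ENNReal.ofReal (√(2 / Real.pi) * √((b : ℝ) - a)) := by
  have h := hW.hasLaw_sub b a
  have hd : ((nndist b.1 a.1 : ℝ≥0) : ℝ) = (b : ℝ) - a := by
    rw [coe_nndist, Real.dist_eq, abs_of_nonneg (sub_nonneg.2 (by exact_mod_cast hab))]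
    rfl
  rw [← hd, ← integral_abs_gaussianReal]
  have h2 := h.lintegral_comp (f := fun x : ℝ => ‖x‖ₑ) (by fun_prop)
  simp only [Pi.sub_apply] at h2
  rw [h2, ← ofReal_integral_norm_eq_lintegral_enorm]
  · rfl
  · exact (memLp_id_gaussianReal 1).integrable le_rfl

lemma lintegral_enorm_increment_sq {a b : ℝ≥0} (hab : a ≤ b) :
    ∫⁻ ω, ‖W b ω - W a ω‖ₑ ^ 2 ∂P = ENNReal.ofReal ((b : ℝ) - a) := by
  have h := hW.hasLaw_sub b a
  have hd : ((nndist b.1 a.1 : ℝ≥0) : ℝ) = (b : ℝ) - a := by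
    rw [coe_nndist, Real.dist_eq, abs_of_nonneg (sub_nonneg.2 (by exact_mod_cast hab))]
    rfl
  have h2 := h.lintegral_comp (f := fun x : ℝ => ‖x‖ₑ ^ 2) (by fun_prop)
  simp only [Pi.sub_apply] at h2
  rw [h2, ← hd]
  set v := nndist b.1 a.1
  have h3 : evariance id (gaussianReal 0 v) = ENNReal.ofReal v := by
    rw [← variance_id_gaussianReal (μ := 0) (v := v), ofReal_variance]
    exact memLp_id_gaussianReal 2
  rw [← h3, evariance]
  simp

lemma lintegral_enorm_increment_mul {a b c d : ℝ≥0} (hab : a ≤ b) (hbc : b ≤ c) (hcd : c ≤ d) :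
    ∫⁻ ω, ‖W b ω - W a ω‖ₑ * ‖W d ω - W c ω‖ₑ ∂P
      = ENNReal.ofReal (2 / Real.pi * (√((b : ℝ) - a) * √((d : ℝ) - c))) := by
  have hind : IndepFun (fun ω => W b ω - W a ω) (fun ω => W d ω - W c ω) P := by
    -- The gap from `b` to `c` counts as an increment, so the two of interest have indices `0` and
    -- `2`.
    have h := hW.hasIndepIncrements 3 ![a, b, c, d] (by
      rw [Fin.monotone_iff_le_succ]
      intro i
      fin_cases i <;> simpa)
    exact h.indepFun (i := 0) (j := 2) (by decide)
  have hm := fun u => hW.aemeasurable u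
  have hmul := lintegral_mul_eq_lintegral_mul_lintegral_of_indepFun''
    ((hm b).sub (hm a)).enorm ((hm d).sub (hm c)).enorm
    (hind.comp (φ := fun x : ℝ => ‖x‖ₑ) (ψ := fun x : ℝ => ‖x‖ₑ) (by fun_prop) (by fun_prop))
  simp only [Pi.sub_apply] at hmul
  rw [hmul,
    lintegral_enorm_increment hW hab, lintegral_enorm_increment hW hcd,
    ← ENNReal.ofReal_mul (by positivity)]
  congr 1
  have : √(2 / Real.pi) * √(2 / Real.pi) = 2 / Real.pi := Real.mul_self_sqrt (by positivity)
  linear_combination √((b : ℝ) - a) * √((d : ℝ) - c) * this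

end

/-- Dominated convergence with a converging family of bounds. -/
lemma tendsto_lintegral_of_tendsto_bound {ι : Type*} {l : Filter ι} [l.IsCountablyGenerated]
    {μ : Measure Ω} {f g : ι → Ω → ℝ≥0∞} {f₀ g₀ : Ω → ℝ≥0∞}
    (hf : ∀ᶠ i in l, AEMeasurable (f i) μ) (hg : ∀ᶠ i in l, AEMeasurable (g i) μ)
    (hg₀ : AEMeasurable g₀ μ) (hfg : ∀ᶠ i in l, f i ≤ᵐ[μ] g i)
    (hf_lim : ∀ᵐ ω ∂μ, Tendsto (fun i => f i ω) l (𝓝 (f₀ ω)))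
    (hg_lim : ∀ᵐ ω ∂μ, Tendsto (fun i => g i ω) l (𝓝 (g₀ ω)))
    (hle : ∀ᵐ ω ∂μ, f₀ ω ≤ g₀ ω)
    (hint : Tendsto (fun i => ∫⁻ ω, g i ω ∂μ) l (𝓝 (∫⁻ ω, g₀ ω ∂μ)))
    (hfin : ∫⁻ ω, g₀ ω ∂μ ≠ ∞) :
    Tendsto (fun i => ∫⁻ ω, f i ω ∂μ) l (𝓝 (∫⁻ ω, f₀ ω ∂μ)) := by
  -- Truncation at `g₀` brings ordinary dominated convergence into play. The excess `f - min f g₀`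
  -- is at most `g - min g g₀`, whose integral tends to `0`.
  have hmin : ∀ (k : ι → Ω → ℝ≥0∞) (k₀ : Ω → ℝ≥0∞), (∀ᶠ i in l, AEMeasurable (k i) μ) →
      (∀ᵐ ω ∂μ, Tendsto (fun i => k i ω) l (𝓝 (k₀ ω))) → (∀ᵐ ω ∂μ, k₀ ω ≤ g₀ ω) →
      Tendsto (fun i => ∫⁻ ω, min (k i ω) (g₀ ω) ∂μ) l (𝓝 (∫⁻ ω, k₀ ω ∂μ)) := by
    intro k k₀ hk hk_lim hk_le
    have : ∫⁻ ω, k₀ ω ∂μ = ∫⁻ ω, min (k₀ ω) (g₀ ω) ∂μ := by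
      refine lintegral_congr_ae ?_
      filter_upwards [hk_le] with ω h using (min_eq_left h).symm
    rw [this]
    refine tendsto_lintegral_filter_of_dominated_convergence' g₀ ?_ ?_ hfin ?_
    · filter_upwards [hk] with i hi using hi.min hg₀
    · exact Eventually.of_forall fun i => Eventually.of_forall fun ω => min_le_right _ _
    · filter_upwards [hk_lim] with ω h using h.min tendsto_const_nhds
  have h1 := hmin f f₀ hf hf_lim hle
  have h2 := hmin g g₀ hg hg_lim (Eventually.of_forall fun _ => le_rfl)
  have h3 : Tendsto (fun i => ∫⁻ ω, g i ω ∂μ - ∫⁻ ω, min (g i ω) (g₀ ω) ∂μ) l (𝓝 0) := by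
    have := ENNReal.Tendsto.sub hint h2 (Or.inl hfin)
    rwa [tsub_self] at this
  have h4 := h1.add h3
  rw [add_zero] at h4
  refine tendsto_of_tendsto_of_tendsto_of_le_of_le' h1 h4 ?_ ?_
  · exact Eventually.of_forall fun i => lintegral_mono fun ω => min_le_left _ _
  · filter_upwards [hf, hg, hfg] with i hfi hgi hi
    rw [← lintegral_sub' (hgi.min hg₀)
      (ne_top_of_le_ne_top hfin (lintegral_mono fun ω => min_le_right _ _))
      (Eventually.of_forall fun ω => min_le_left _ _),
      ← lintegral_add_left' (hfi.min hg₀)]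
    refine lintegral_mono_ae ?_
    filter_upwards [hi] with ω hω
    rcases le_total (f i ω) (g₀ ω) with h | h
    · rw [min_eq_left h]
      exact le_self_add
    · rw [min_eq_right h, min_eq_right (h.trans hω), add_tsub_cancel_of_le (h.trans hω)]
      exact hω

end VolModel

end

/-! ### The age of a Poisson process: its law and independence -/

noncomputable section

namespace VolModel

variable {Ω : Type*} [MeasurableSpace Ω] {P : Measure Ω} {τ : ℤ → Ω → ℝ} {lam : ℝ}

omit [MeasurableSpace Ω] in
lemma pointCount_eq_zero_iff {A : Set ℝ} {ω : Ω} :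
    pointCount τ A ω = 0 ↔ ∀ n, τ n ω ∉ A := by
  simp [pointCount, Set.eq_empty_iff_forall_notMem]

lemma expMeasure_one_Ioi (u : ℝ) :
    expMeasure 1 (Set.Ioi u) = ENNReal.ofReal (Real.exp (-max u 0)) := by
  have : IsProbabilityMeasure (expMeasure 1) := isProbabilityMeasure_expMeasure one_pos
  rw [← ofReal_measureReal, ← Set.compl_Iic, probReal_compl_eq_one_sub measurableSet_Iic,
    ← cdf_eq_real, cdf_expMeasure_eq one_pos]
  split_ifs with h
  · simp [h]
  · simp [(not_le.1 h).le]

namespace IsPoissonPointProcess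

variable (hτ : IsPoissonPointProcess τ lam P)
include hτ

lemma measure_pointCount_eq_zero {A : Set ℝ} (hA : MeasurableSet A) (hA' : volume A ≠ ∞) :
    P {ω | pointCount τ A ω = 0}
      = ENNReal.ofReal (Real.exp (-(lam * volume.real A).toNNReal)) := by
  have hms : MeasurableSet {k : ℕ∞ | k = 0} := measurableSet_singleton 0
  have h := (hτ.law_count A hA hA').measure_eq (p := fun k => k = 0) hms
  have hpre : (Nat.cast : ℕ → ℕ∞) ⁻¹' {x | x = 0} = {0} := by
    ext n
    simp
  rw [h, Measure.map_apply (measurable_of_countable _) hms,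
    hpre, poissonMeasure_singleton]
  simp

/-- Only accumulation must be excluded: a bounded sequence of points would put infinitely many of
them in some `[0, N]`, whose count is Poisson and hence finite. -/
lemma ae_isRegular : ∀ᵐ ω ∂P, IsRegular fun n => τ n ω := by
  have hfin : ∀ᵐ ω ∂P, ∀ N : ℕ, pointCount τ (Set.Icc 0 N) ω ≠ (⊤ : ℕ∞) := by
    rw [ae_all_iff]
    intro N
    have h := hτ.law_count (Set.Icc 0 N) measurableSet_Icc (by simp)
    have hms : MeasurableSet {k : ℕ∞ | k ≠ ⊤} := (measurableSet_singleton ⊤).compl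
    refine (h.ae_iff (p := fun k => k ≠ (⊤ : ℕ∞)) (measurableSet_setOfPred.1 hms)).2 ?_
    rw [ae_map_iff (measurable_of_countable _).aemeasurable hms]
    exact Eventually.of_forall fun n => ENat.natCast_ne_top n
  filter_upwards [hτ.strictMono, hτ.label, hfin] with ω h1 h2 h3
  refine ⟨h1, h2.1, h2.2, fun t => ?_⟩
  by_contra! hc
  obtain ⟨N, hN⟩ := exists_nat_ge t
  refine h3 N (Set.encard_eq_top_iff.2 ?_)
  refine Set.infinite_of_injective_forall_mem (f := fun n : ℕ => (n : ℤ) + 1)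
    (fun a b hab => by simpa using hab) fun n => ?_
  refine ⟨h2.2.le.trans (h1.monotone (by omega)), ?_⟩
  exact (by exact_mod_cast hc (n + 1) : τ ((n : ℤ) + 1) ω ≤ t).trans hN

lemma measurable_path : Measurable fun ω n => τ n ω := measurable_pi_iff.2 hτ.measurable

lemma setOf_lt_age_ae_eq {t : ℝ} (ht : 0 ≤ t) (u : ℝ) :
    {ω | u < age (fun n => τ n ω) t}
      =ᵐ[P] {ω | pointCount τ (Set.Icc (t - u) t) ω = 0} := by
  filter_upwards [hτ.ae_isRegular] with ω hω
  exact propext ((hω.lt_age_iff ht).trans pointCount_eq_zero_iff.symm)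

lemma measure_lt_age (hlam : 0 < lam) {t : ℝ} (ht : 0 ≤ t) (u : ℝ) :
    P {ω | u < age (fun n => τ n ω) t} = ENNReal.ofReal (Real.exp (-(lam * max u 0))) := by
  rw [measure_congr (hτ.setOf_lt_age_ae_eq ht u),
    hτ.measure_pointCount_eq_zero measurableSet_Icc (by simp), measureReal_def, Real.volume_Icc]
  congr 3
  rw [sub_sub_cancel, ENNReal.toReal_ofReal', Real.coe_toNNReal]
  positivity

/-- The tail is a void probability. Since the process is two-sided, the age is not truncated at `t`,
and its law does not depend on `t`. -/
lemma map_age [IsProbabilityMeasure P] (hlam : 0 < lam) {t : ℝ} (ht : 0 ≤ t) :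
    P.map (fun ω => lam * age (fun n => τ n ω) t) = expMeasure 1 := by
  have hm : Measurable fun ω => lam * age (fun n => τ n ω) t :=
    ((measurable_age_left t).comp hτ.measurable_path).const_mul lam
  have : IsProbabilityMeasure (expMeasure 1) := isProbabilityMeasure_expMeasure one_pos
  have : IsProbabilityMeasure (P.map fun ω => lam * age (fun n => τ n ω) t) :=
    Measure.isProbabilityMeasure_map hm.aemeasurable
  refine Measure.ext_of_Iic _ _ fun a => ?_
  rw [← compl_compl (Set.Iic a), prob_compl_eq_one_sub measurableSet_Iic.compl,
    prob_compl_eq_one_sub measurableSet_Iic.compl]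
  congr 1
  rw [Set.compl_Iic, expMeasure_one_Ioi, Measure.map_apply hm measurableSet_Ioi]
  have : (fun ω => lam * age (fun n => τ n ω) t) ⁻¹' Set.Ioi a
      = {ω | a / lam < age (fun n => τ n ω) t} := by
    ext ω
    simp [div_lt_iff₀' hlam]
  rw [this, hτ.measure_lt_age hlam ht]
  congr 3
  rw [mul_max_of_nonneg _ _ hlam.le]
  field_simp
  simp

/-- The age at `s` is independent of the age at `t`, truncated at `t - s`. -/
lemma indepFun_age_min [IsProbabilityMeasure P] {s t : ℝ} (hs : 0 ≤ s) (hst : s < t) :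
    IndepFun (fun ω => age (fun n => τ n ω) s) (fun ω => min (age (fun n => τ n ω) t) (t - s))
      P := by
  have hm : ∀ r, Measurable fun ω => age (fun n => τ n ω) r := fun r =>
    (measurable_age_left r).comp hτ.measurable_path
  have hgen : ∀ f : Ω → ℝ, MeasurableSpace.comap f inferInstance
      = MeasurableSpace.generateFrom (Set.preimage f '' Set.range Set.Ioi) := by
    intro f
    rw [BorelSpace.measurable_eq (α := ℝ), borel_eq_generateFrom_Ioi,
      MeasurableSpace.comap_generateFrom]
  refine IndepSets.indep (hm s).comap_le ((hm t).min measurable_const).comap_le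
    (isPiSystem_Ioi.comap _) (isPiSystem_Ioi.comap _) (hgen _) (hgen _) ?_
  rw [IndepSets_iff]
  rintro _ _ ⟨_, ⟨u, rfl⟩, rfl⟩ ⟨_, ⟨v, rfl⟩, rfl⟩
  -- The truncated age never exceeds `t - s`. For `v < t - s` the two events say that `[s - u, s]`
  -- and `[t - v, t]` are void, and these intervals are disjoint.
  rcases le_or_gt (t - s) v with hv | hv
  · have : (fun ω => min (age (fun n => τ n ω) t) (t - s)) ⁻¹' Set.Ioi v = ∅ := by
      ext ω
      simp [hv]
    simp [this]
  · have h1 := hτ.setOf_lt_age_ae_eq hs u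
    have h2 := hτ.setOf_lt_age_ae_eq (hs.trans hst.le) v
    have e1 : (fun ω => age (fun n => τ n ω) s) ⁻¹' Set.Ioi u
        = {ω | u < age (fun n => τ n ω) s} := rfl
    have e2 : (fun ω => min (age (fun n => τ n ω) t) (t - s)) ⁻¹' Set.Ioi v
        = {ω | v < age (fun n => τ n ω) t} := by
      ext ω
      simp [hv]
    rw [e1, e2, measure_congr h1, measure_congr h2, measure_congr (h1.inter h2)]
    have hdis : Disjoint (Set.Icc (s - u) s) (Set.Icc (t - v) t) := by
      rw [Set.disjoint_left]
      rintro r ⟨_, hr⟩ ⟨hr', _⟩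
      linarith
    have hi := hτ.indep_count 2 ![Set.Icc (s - u) s, Set.Icc (t - v) t]
      (by intro j; fin_cases j <;> exact measurableSet_Icc)
      (by
        intro i j hij
        fin_cases i <;> fin_cases j <;> simp_all [hdis.symm])
    have := (hi.indepFun (i := 0) (j := 1) (by decide)).measure_inter_preimage_eq_mul
      {0} {0} (measurableSet_singleton _) (measurableSet_singleton _)
    exact this

end IsPoissonPointProcess

end VolModel

end

/-! ### Moments of powers of the exponential variable, and `φ` -/

noncomputable section

namespace VolModel

variable {Ω : Type*} [MeasurableSpace Ω]

lemma memLp_two_of_lintegral_enorm_sq {μ : Measure Ω} {f : Ω → ℝ} (hf : AEMeasurable f μ)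
    (h : ∫⁻ ω, ‖f ω‖ₑ ^ 2 ∂μ ≠ ∞) : MemLp f 2 μ := by
  refine ⟨hf.aestronglyMeasurable, ?_⟩
  rw [eLpNorm_lt_top_iff_lintegral_rpow_enorm_lt_top (by norm_num) (by norm_num)]
  simpa using h.lt_top

lemma covariance_eq_lintegral {μ : Measure Ω} [IsProbabilityMeasure μ] {f g : Ω → ℝ}
    (hf : MemLp f 2 μ) (hg : MemLp g 2 μ) (hf₀ : 0 ≤ᵐ[μ] f) (hg₀ : 0 ≤ᵐ[μ] g) :
    covariance f g μ = (∫⁻ ω, ‖f ω‖ₑ * ‖g ω‖ₑ ∂μ).toReal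
      - (∫⁻ ω, ‖f ω‖ₑ ∂μ).toReal * (∫⁻ ω, ‖g ω‖ₑ ∂μ).toReal := by
  have key : ∀ k : Ω → ℝ, AEStronglyMeasurable k μ → 0 ≤ᵐ[μ] k →
      ∫ ω, k ω ∂μ = (∫⁻ ω, ‖k ω‖ₑ ∂μ).toReal := by
    intro k hk hk₀
    rw [← integral_norm_eq_lintegral_enorm hk]
    refine integral_congr_ae ?_
    filter_upwards [hk₀] with ω hω using (Real.norm_of_nonneg hω).symm
  rw [covariance_eq_sub hf hg, key f hf.1 hf₀, key g hg.1 hg₀, key (f * g) (hf.1.mul hg.1)]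
  · simp only [Pi.mul_apply, enorm_mul]
  · filter_upwards [hf₀, hg₀] with ω h1 h2 using mul_nonneg h1 h2

instance : IsProbabilityMeasure (expMeasure 1) := isProbabilityMeasure_expMeasure one_pos

instance : NullSingletonClass (expMeasure 1) where
  measure_singleton a := by
    rw [expMeasure, gammaMeasure]
    exact withDensity_absolutelyContinuous _ _ (measure_singleton a)

lemma lintegral_expMeasure_one {f : ℝ → ℝ≥0∞} (hf : Measurable f) :
    ∫⁻ u, f u ∂(expMeasure 1) = ∫⁻ u in Set.Ioi 0, ENNReal.ofReal (Real.exp (-u)) * f u := by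
  have hpdf : gammaPDF 1 1 = fun u => ENNReal.ofReal (gammaPDFReal 1 1 u) := rfl
  rw [expMeasure, gammaMeasure, hpdf, lintegral_withDensity_eq_lintegral_mul _
    (measurable_gammaPDFReal 1 1).ennreal_ofReal hf, ← lintegral_indicator measurableSet_Ioi]
  refine lintegral_congr_ae ?_
  have h0 : ∀ᵐ u : ℝ, u ≠ 0 := by simp [ae_iff]
  filter_upwards [h0] with u hu
  rcases lt_or_gt_of_ne hu with h | h
  · simp [gammaPDFReal, h.not_ge, h.le]
  · simp [gammaPDFReal, h, h.le]

lemma ae_expMeasure_one_pos : ∀ᵐ u ∂(expMeasure 1), 0 < u := by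
  rw [ae_iff]
  have := prob_compl_eq_zero_iff (μ := expMeasure 1) (measurableSet_Ioi (a := (0 : ℝ)))
  have h2 : {a : ℝ | ¬ 0 < a} = (Set.Ioi 0)ᶜ := by
    ext
    simp
  rw [h2, this, expMeasure_one_Ioi]
  simp

variable {D : ℝ}

/-- This is the Gamma integral at `2 * D > 0`. -/
lemma lintegral_rpow_expMeasure_one_ne_top (hD₀ : 0 < D) :
    ∫⁻ u, ENNReal.ofReal (u ^ (2 * D - 1)) ∂(expMeasure 1) ≠ ∞ := by
  rw [lintegral_expMeasure_one (by fun_prop)]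
  have h := Real.GammaIntegral_convergent (s := 2 * D) (by linarith)
  have h2 := h.lintegral_lt_top
  convert h2.ne using 1
  refine setLIntegral_congr_fun measurableSet_Ioi fun u _ => ?_
  exact (ENNReal.ofReal_mul (Real.exp_pos _).le).symm

lemma rpow_sub_half_sq {u : ℝ} (hu : 0 ≤ u) : (u ^ (D - 1 / 2)) ^ 2 = u ^ (2 * D - 1) := by
  rw [← Real.rpow_mul_natCast hu]
  congr 1
  push_cast
  ring

/-- The exponent is nonpositive, so the shift by `x` only decreases the power and `x = 0` is the
worst case. -/
lemma memLp_rpow_add (hD₀ : 0 < D) (hD₁ : D ≤ 1 / 2) {x : ℝ} (hx : 0 ≤ x) :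
    MemLp (fun u : ℝ => (u + x) ^ (D - 1 / 2)) 2 (expMeasure 1) := by
  refine memLp_two_of_lintegral_enorm_sq (by fun_prop) (ne_top_of_le_ne_top
    (lintegral_rpow_expMeasure_one_ne_top hD₀) (lintegral_mono_ae ?_))
  filter_upwards [ae_expMeasure_one_pos] with u hu
  have h1 : 0 ≤ (u + x) ^ (D - 1 / 2) := by positivity
  rw [Real.enorm_eq_ofReal h1, ← ENNReal.ofReal_pow h1, ← rpow_sub_half_sq hu.le]
  refine ENNReal.ofReal_le_ofReal (pow_le_pow_left₀ h1 ?_ 2)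
  exact Real.rpow_le_rpow_of_nonpos hu (by linarith) (by linarith)

lemma memLp_mul_rpow_add {ν : Measure ℝ} [IsProbabilityMeasure ν]
    (hν₂ : Integrable (fun x : ℝ => x ^ 2) ν) (hD₀ : 0 < D) (hD₁ : D ≤ 1 / 2)
    {x : ℝ} (hx : 0 ≤ x) :
    MemLp (fun p : ℝ × ℝ => p.1 * (p.2 + x) ^ (D - 1 / 2)) 2 (ν.prod (expMeasure 1)) := by
  have h1 : MemLp (fun y : ℝ => y) 2 ν := (memLp_two_iff_integrable_sq (by fun_prop)).2 hν₂
  have h2 := memLp_rpow_add hD₀ hD₁ hx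
  have hm : Measurable fun p : ℝ × ℝ => p.1 * (p.2 + x) ^ (D - 1 / 2) := by fun_prop
  rw [memLp_two_iff_integrable_sq h2.1] at h2
  rw [memLp_two_iff_integrable_sq h1.1] at h1
  rw [memLp_two_iff_integrable_sq hm.aestronglyMeasurable]
  simpa only [mul_pow] using h1.mul_prod h2

/-- The moments of `σ` and of the powers of the exponential variable in the definition of `φ`. -/
lemma phi_eq {ν : Measure ℝ} [IsProbabilityMeasure ν] (hν : ∀ᵐ x ∂ν, 0 < x)
    (hν₂ : Integrable (fun x : ℝ => x ^ 2) ν) (hD₀ : 0 < D) (hD₁ : D ≤ 1 / 2)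
    {x : ℝ} (hx : 0 ≤ x) :
    phi D ν x = ((∫⁻ y, ‖y‖ₑ ^ 2 ∂ν) *
          ∫⁻ u, ‖u ^ (D - 1 / 2)‖ₑ * ‖(u + x) ^ (D - 1 / 2)‖ₑ ∂(expMeasure 1)).toReal
      - ((∫⁻ y, ‖y‖ₑ ∂ν) * ∫⁻ u, ‖u ^ (D - 1 / 2)‖ₑ ∂(expMeasure 1)).toReal
        * ((∫⁻ y, ‖y‖ₑ ∂ν) * ∫⁻ u, ‖(u + x) ^ (D - 1 / 2)‖ₑ ∂(expMeasure 1)).toReal := by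
  have hpos : ∀ᵐ p : ℝ × ℝ ∂(ν.prod (expMeasure 1)), 0 < p.1 ∧ 0 < p.2 :=
    (Measure.quasiMeasurePreserving_fst.ae hν).and
      (Measure.quasiMeasurePreserving_snd.ae ae_expMeasure_one_pos)
  have h0 := memLp_mul_rpow_add hν₂ hD₀ hD₁ le_rfl
  simp only [add_zero] at h0
  unfold phi
  rw [covariance_eq_lintegral h0 (memLp_mul_rpow_add hν₂ hD₀ hD₁ hx)]
  · simp only [enorm_mul]
    rw [lintegral_prod_mul (f := fun y : ℝ => ‖y‖ₑ) (g := fun u : ℝ => ‖u ^ (D - 1 / 2)‖ₑ)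
      (by fun_prop) (by fun_prop),
      lintegral_prod_mul (f := fun y : ℝ => ‖y‖ₑ) (g := fun u : ℝ => ‖(u + x) ^ (D - 1 / 2)‖ₑ)
      (by fun_prop) (by fun_prop),
      ← lintegral_prod_mul (f := fun y : ℝ => ‖y‖ₑ ^ 2)
        (g := fun u : ℝ => ‖u ^ (D - 1 / 2)‖ₑ * ‖(u + x) ^ (D - 1 / 2)‖ₑ)
      (by fun_prop) (by fun_prop)]
    congr 3
    ext p
    ring
  · filter_upwards [hpos] with p hp
    have := hp.1
    have := hp.2
    simp only [Pi.zero_apply]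
    positivity
  · filter_upwards [hpos] with p hp
    have := hp.1
    have := hp.2
    simp only [Pi.zero_apply]
    positivity

end VolModel

end

/-! ### First and second moments of the volatility and of the rate -/

noncomputable section

namespace VolModel

variable {Ω : Type*} [MeasurableSpace Ω] {P : Measure Ω} [IsProbabilityMeasure P]
  {D lam : ℝ} {ν : Measure ℝ} {W : ℝ≥0 → Ω → ℝ} {τ : ℤ → Ω → ℝ} {σ : ℕ → Ω → ℝ}

/-- The value at the point configuration and the marks of the path `ω`. -/
def noisePath (τ : ℤ → Ω → ℝ) (σ : ℕ → Ω → ℝ) (ω : Ω) : (ℤ → ℝ) × (ℕ → ℝ) :=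
  (fun n => τ n ω, fun n => σ n ω)

/-- Up to a constant factor, the square root of the derivative of the time change. -/
def volatility (D lam : ℝ) (τ : ℤ → Ω → ℝ) (σ : ℕ → Ω → ℝ) (t : ℝ) (ω : Ω) : ℝ≥0∞ :=
  ‖(lam * age (fun n => τ n ω) t) ^ (D - 1 / 2)‖ₑ * ‖σ (lastIdx (fun n => τ n ω) t) ω‖ₑ

namespace IsNoise

variable (hN : IsNoise lam ν W τ σ P)
include hN

omit [IsProbabilityMeasure P] in
lemma measurable_marks : Measurable fun ω n => σ n ω := measurable_pi_iff.2 hN.measurable_σ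

omit [IsProbabilityMeasure P] in
lemma measurable_noisePath : Measurable (noisePath τ σ) :=
  hN.poisson.measurable_path.prodMk hN.measurable_marks

/-- The random index depends on `τ` alone; once `τ` is frozen, the selected mark is a single `σ n`
with law `ν`. -/
lemma lintegral_mul_mark {G : (ℤ → ℝ) → ℝ≥0∞} (hG : Measurable G) {g : ℝ → ℝ≥0∞}
    (hg : Measurable g) {N : (ℤ → ℝ) → ℕ} (hNm : Measurable N) :
    ∫⁻ ω, G (fun n => τ n ω) * g (σ (N fun n => τ n ω) ω) ∂P
      = (∫⁻ ω, G (fun n => τ n ω) ∂P) * ∫⁻ y, g y ∂ν := by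
  have hGm : Measurable fun ω => G fun n => τ n ω := hG.comp hN.poisson.measurable_path
  have hF : Measurable fun q : (ℕ → ℝ) × (ℤ → ℝ) => G q.2 * g (q.1 (N q.2)) :=
    (hG.comp measurable_snd).mul (hg.comp
      (measurable_apply_nat (f := fun k (q : (ℕ → ℝ) × (ℤ → ℝ)) => q.1 k)
        (hNm.comp measurable_snd) fun k => by fun_prop))
  rw [lintegral_comp_of_indepFun (X := fun ω n => σ n ω) (Y := fun ω n => τ n ω)
    hN.measurable_marks hN.poisson.measurable_path hN.indep_τ_σ.symm hF,
    ← lintegral_mul_const _ hGm]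
  refine lintegral_congr fun ω => ?_
  exact (lintegral_const_mul (G fun n => τ n ω) (hg.comp (hN.measurable_σ (N fun n => τ n ω)))).trans
    (congrArg _ ((hN.law_σ (N fun n => τ n ω)).lintegral_comp hg.aemeasurable))

/-- With `τ` frozen and `G ≠ 0` the indices are two distinct integers, so the marks are independent;
where `G = 0` both integrands vanish. -/
lemma lintegral_mul_mark_mul_mark {G : (ℤ → ℝ) → ℝ≥0∞} (hG : Measurable G) {g : ℝ → ℝ≥0∞}
    (hg : Measurable g) {M N : (ℤ → ℝ) → ℕ} (hMm : Measurable M) (hNm : Measurable N)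
    (hMN : ∀ᵐ ω ∂P, G (fun n => τ n ω) ≠ 0 → M (fun n => τ n ω) ≠ N fun n => τ n ω) :
    ∫⁻ ω, G (fun n => τ n ω) * (g (σ (M fun n => τ n ω) ω) * g (σ (N fun n => τ n ω) ω)) ∂P
      = (∫⁻ ω, G (fun n => τ n ω) ∂P) * ((∫⁻ y, g y ∂ν) * ∫⁻ y, g y ∂ν) := by
  have hmark : ∀ K : (ℤ → ℝ) → ℕ, Measurable K →
      Measurable fun q : (ℕ → ℝ) × (ℤ → ℝ) => g (q.1 (K q.2)) := fun K hK =>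
    hg.comp (measurable_apply_nat (f := fun k (q : (ℕ → ℝ) × (ℤ → ℝ)) => q.1 k)
      (hK.comp measurable_snd) fun k => by fun_prop)
  have hGm : Measurable fun ω => G fun n => τ n ω := hG.comp hN.poisson.measurable_path
  have hF : Measurable fun q : (ℕ → ℝ) × (ℤ → ℝ) =>
      G q.2 * (g (q.1 (M q.2)) * g (q.1 (N q.2))) :=
    (hG.comp measurable_snd).mul ((hmark M hMm).mul (hmark N hNm))
  rw [lintegral_comp_of_indepFun (X := fun ω n => σ n ω) (Y := fun ω n => τ n ω)
    hN.measurable_marks hN.poisson.measurable_path hN.indep_τ_σ.symm hF,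
    ← lintegral_mul_const _ hGm]
  refine lintegral_congr_ae ?_
  filter_upwards [hMN] with ω hω
  have hgm : ∀ n, Measurable fun ω => g (σ n ω) := fun n => hg.comp (hN.measurable_σ n)
  refine (lintegral_const_mul _ ((hgm (M fun n => τ n ω)).mul (hgm (N fun n => τ n ω)))).trans ?_
  by_cases h0 : G (fun n => τ n ω) = 0
  · simp [h0]
  · have hmul := lintegral_mul_eq_lintegral_mul_lintegral_of_indepFun
      (hgm _) (hgm _) ((hN.iIndep_σ.indepFun (hω h0)).comp hg hg)
    rw [hmul, (hN.law_σ _).lintegral_comp hg.aemeasurable,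
      (hN.law_σ _).lintegral_comp hg.aemeasurable]

lemma lintegral_age (hlam : 0 < lam) {t : ℝ} (ht : 0 ≤ t) {f : ℝ → ℝ≥0∞} (hf : Measurable f) :
    ∫⁻ ω, f (lam * age (fun n => τ n ω) t) ∂P = ∫⁻ u, f u ∂(expMeasure 1) := by
  rw [← hN.poisson.map_age hlam ht, lintegral_map hf]
  exact ((measurable_age_left t).comp hN.poisson.measurable_path).const_mul lam

lemma lintegral_volatility (hlam : 0 < lam) {t : ℝ} (ht : 0 ≤ t) :
    ∫⁻ ω, volatility D lam τ σ t ω ∂P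
      = (∫⁻ y, ‖y‖ₑ ∂ν) * ∫⁻ u, ‖u ^ (D - 1 / 2)‖ₑ ∂(expMeasure 1) := by
  have hm := measurable_age_left t
  unfold volatility
  rw [hN.lintegral_mul_mark (G := fun x => ‖(lam * age x t) ^ (D - 1 / 2)‖ₑ)
    (by fun_prop) (g := fun y => ‖y‖ₑ) (by fun_prop) (measurable_lastIdx_left t),
    hN.lintegral_age hlam ht (f := fun u => ‖u ^ (D - 1 / 2)‖ₑ) (by fun_prop), mul_comm]

lemma lintegral_clockRate_eq (hlam : 0 < lam) {t : ℝ} (ht : 0 ≤ t) :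
    ∫⁻ ω, ENNReal.ofReal (clockRate D (noisePath τ σ ω).1 (noisePath τ σ ω).2 t) ∂P
      = (∫⁻ u, ENNReal.ofReal (2 * D * (lam⁻¹ * u) ^ (2 * D - 1)) ∂(expMeasure 1))
        * ∫⁻ y, ENNReal.ofReal (y ^ 2) ∂ν := by
  have hm := measurable_age_left t
  rw [← hN.lintegral_age hlam ht (by fun_prop), ← hN.lintegral_mul_mark
    (G := fun x => ENNReal.ofReal (2 * D * (lam⁻¹ * (lam * age x t)) ^ (2 * D - 1)))
    (by fun_prop) (by fun_prop) (measurable_lastIdx_left t)]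
  refine lintegral_congr fun ω => ?_
  simp only [clockRate, noisePath]
  rw [ENNReal.ofReal_mul (sq_nonneg _), mul_comm, inv_mul_cancel_left₀ hlam.ne']

/-- Tonelli, together with the fact that the expected rate is the same at all times. -/
lemma lintegral_clock_sub (hD₀ : 0 < D) (hlam : 0 < lam) {s t : ℝ} (hs : 0 ≤ s) (hst : s ≤ t) :
    ∫⁻ ω, ENNReal.ofReal (clock D (noisePath τ σ ω).1 (noisePath τ σ ω).2 t
        - clock D (noisePath τ σ ω).1 (noisePath τ σ ω).2 s) ∂P
      = ENNReal.ofReal (t - s) *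
        ∫⁻ ω, ENNReal.ofReal (clockRate D (noisePath τ σ ω).1 (noisePath τ σ ω).2 s) ∂P := by
  have h1 : ∫⁻ ω, ENNReal.ofReal (clock D (noisePath τ σ ω).1 (noisePath τ σ ω).2 t
        - clock D (noisePath τ σ ω).1 (noisePath τ σ ω).2 s) ∂P
      = ∫⁻ ω, ∫⁻ r in Set.Ioc s t,
        ENNReal.ofReal (clockRate D (noisePath τ σ ω).1 (noisePath τ σ ω).2 r) ∂volume ∂P := by
    refine lintegral_congr_ae ?_
    filter_upwards [hN.poisson.ae_isRegular] with ω hω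
    exact (lintegral_clockRate_Ioc hD₀ hω _ hs hst).symm
  rw [h1, lintegral_lintegral_swap]
  · rw [setLIntegral_congr_fun (g := fun _ =>
      ∫⁻ ω, ENNReal.ofReal (clockRate D (noisePath τ σ ω).1 (noisePath τ σ ω).2 s) ∂P)
      measurableSet_Ioc fun r hr => ?_]
    · simp [mul_comm]
    · simp only
      rw [hN.lintegral_clockRate_eq hlam hs, hN.lintegral_clockRate_eq hlam (hs.trans hr.1.le)]
  · refine Measurable.aemeasurable ?_
    exact ((measurable_clockRate D).comp ((hN.measurable_noisePath.comp measurable_fst).prodMk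
      measurable_snd)).ennreal_ofReal

lemma lintegral_clockRate_ne_top (hD₀ : 0 < D) (hlam : 0 < lam)
    (hν₂ : Integrable (fun x : ℝ => x ^ 2) ν) {t : ℝ} (ht : 0 ≤ t) :
    ∫⁻ ω, ENNReal.ofReal (clockRate D (noisePath τ σ ω).1 (noisePath τ σ ω).2 t) ∂P ≠ ∞ := by
  rw [hN.lintegral_clockRate_eq hlam ht]
  refine ENNReal.mul_ne_top ?_ hν₂.lintegral_lt_top.ne
  have : ∫⁻ u, ENNReal.ofReal (2 * D * (lam⁻¹ * u) ^ (2 * D - 1)) ∂(expMeasure 1)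
      = ∫⁻ u, ENNReal.ofReal (2 * D * lam⁻¹ ^ (2 * D - 1)) * ENNReal.ofReal (u ^ (2 * D - 1))
        ∂(expMeasure 1) := by
    refine lintegral_congr_ae ?_
    filter_upwards [ae_expMeasure_one_pos] with u hu
    rw [← ENNReal.ofReal_mul (by positivity), Real.mul_rpow (by positivity) hu.le]
    ring_nf
  rw [this, lintegral_const_mul _ (by fun_prop)]
  exact ENNReal.mul_ne_top ENNReal.ofReal_ne_top (lintegral_rpow_expMeasure_one_ne_top hD₀)

/-- The second moments of the volatility at two times, decomposed according to whether there is a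
point between them; `κ` is the contribution of the configurations with a point in between. -/
lemma exists_lintegral_volatility_mul (hlam : 0 < lam) {s t : ℝ} (hs : 0 ≤ s) (hst : s < t) :
    ∃ κ : ℝ≥0∞,
      ∫⁻ u, ‖u ^ (D - 1 / 2)‖ₑ ∂(expMeasure 1)
        = ENNReal.ofReal (Real.exp (-(lam * (t - s)))) *
          (∫⁻ u, ‖(u + lam * (t - s)) ^ (D - 1 / 2)‖ₑ ∂(expMeasure 1)) + κ ∧
      ∫⁻ ω, volatility D lam τ σ s ω * volatility D lam τ σ t ω ∂P
        = ENNReal.ofReal (Real.exp (-(lam * (t - s)))) * ((∫⁻ y, ‖y‖ₑ ^ 2 ∂ν) *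
          ∫⁻ u, ‖u ^ (D - 1 / 2)‖ₑ * ‖(u + lam * (t - s)) ^ (D - 1 / 2)‖ₑ ∂(expMeasure 1))
          + (∫⁻ y, ‖y‖ₑ ∂ν) ^ 2 * (∫⁻ u, ‖u ^ (D - 1 / 2)‖ₑ ∂(expMeasure 1)) * κ := by
  set p := D - 1 / 2 with hp
  set d := t - s with hd
  have hd₀ : 0 < d := sub_pos.2 hst
  have ht : 0 ≤ t := hs.trans hst.le
  -- Both functions are applied to the age at `t` truncated at `d`, which is independent of the age
  -- at `s`. `χ₁` selects the configurations with no point in `(s, t]`; `χ₂` keeps the power of the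
  -- age on the others.
  set χ₁ : ℝ → ℝ≥0∞ := (Set.Ici d).indicator 1 with hχ₁
  set χ₂ : ℝ → ℝ≥0∞ := (Set.Iio d).indicator fun m => ‖(lam * m) ^ p‖ₑ with hχ₂
  have mχ₁ : Measurable χ₁ := measurable_one.indicator measurableSet_Ici
  have mχ₂ : Measurable χ₂ := Measurable.indicator (by fun_prop) measurableSet_Iio
  have mA := measurable_age_left s
  have mB := measurable_age_left t
  have mAω : Measurable fun ω => age (fun n => τ n ω) s := mA.comp hN.poisson.measurable_path
  have mBω : Measurable fun ω => min (age (fun n => τ n ω) t) d :=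
    (mB.comp hN.poisson.measurable_path).min measurable_const
  have hind := hN.poisson.indepFun_age_min hs hst
  have hsplit : ∀ f g : ℝ → ℝ≥0∞, Measurable f → Measurable g →
      ∫⁻ ω, f (min (age (fun n => τ n ω) t) d) * g (lam * age (fun n => τ n ω) s) ∂P
        = (∫⁻ ω, f (min (age (fun n => τ n ω) t) d) ∂P) * ∫⁻ u, g u ∂(expMeasure 1) := by
    intro f g hf hg
    rw [← hN.lintegral_age hlam hs hg]
    exact lintegral_mul_eq_lintegral_mul_lintegral_of_indepFun (hf.comp mBω)
      (hg.comp (mAω.const_mul lam)) (hind.symm.comp hf (hg.comp (measurable_const_mul lam)))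
  have hχ₁_int : ∫⁻ ω, χ₁ (min (age (fun n => τ n ω) t) d) ∂P
      = ENNReal.ofReal (Real.exp (-(lam * d))) := by
    have h1 : ∀ ω, χ₁ (min (age (fun n => τ n ω) t) d)
        = (Set.Ici (lam * d)).indicator 1 (lam * age (fun n => τ n ω) t) := by
      intro ω
      simp [hχ₁, Set.indicator_apply, hlam]
    simp_rw [h1]
    rw [hN.lintegral_age hlam ht (measurable_one.indicator measurableSet_Ici),
      lintegral_indicator_one measurableSet_Ici, ← measure_congr Ioi_ae_eq_Ici,
      expMeasure_one_Ioi,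
      max_eq_left (by positivity)]
  refine ⟨∫⁻ ω, χ₂ (min (age (fun n => τ n ω) t) d) ∂P, ?_, ?_⟩
  · have mχ₂ω : Measurable fun ω => χ₂ (min (age (fun n => τ n ω) t) d) := mχ₂.comp mBω
    rw [← hχ₁_int, ← hsplit χ₁ (fun u => ‖(u + lam * d) ^ p‖ₑ) mχ₁ (by fun_prop),
      ← hN.lintegral_age hlam ht (by fun_prop), ← lintegral_add_right _ mχ₂ω]
    refine lintegral_congr_ae ?_
    filter_upwards [hN.poisson.ae_isRegular] with ω hω
    rcases le_or_gt d (age (fun n => τ n ω) t) with h | h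
    · have he := hω.lastIdx_eq_of_le_age hst.le h
      have : lam * age (fun n => τ n ω) t = lam * age (fun n => τ n ω) s + lam * d := by
        simp only [age, he, hd]
        ring
      simp [hχ₁, hχ₂, h, this]
    · simp [hχ₁, hχ₂, h, h.le, h.not_ge]
  -- `h1` treats the case without a point in between, where one mark appears squared; `h2` treats
  -- the other case, where two different marks appear.
  · have h1 := hN.lintegral_mul_mark
      (G := fun x => χ₁ (min (age x t) d) *
        (‖(lam * age x s) ^ p‖ₑ * ‖(lam * age x s + lam * d) ^ p‖ₑ))
      ((mχ₁.comp (mB.min measurable_const)).mul (by fun_prop))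
      (g := fun y => ‖y‖ₑ ^ 2) (by fun_prop) (measurable_lastIdx_left s)
    have h2 := hN.lintegral_mul_mark_mul_mark
      (G := fun x => χ₂ (min (age x t) d) * ‖(lam * age x s) ^ p‖ₑ)
      ((mχ₂.comp (mB.min measurable_const)).mul (by fun_prop))
      (g := fun y => ‖y‖ₑ) (by fun_prop) (measurable_lastIdx_left s) (measurable_lastIdx_left t)
      (by
        filter_upwards [hN.poisson.ae_isRegular] with ω hω hne
        have : age (fun n => τ n ω) t < d := by
          by_contra! hge
          simp [hχ₂, hge] at hne
        exact (hω.lastIdx_ne_of_age_lt hs this).symm)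
    rw [hsplit χ₁ (fun u => ‖u ^ p‖ₑ * ‖(u + lam * d) ^ p‖ₑ) mχ₁ (by fun_prop), hχ₁_int] at h1
    rw [hsplit χ₂ (fun u => ‖u ^ p‖ₑ) mχ₂ (by fun_prop)] at h2
    have hmeas₂ : Measurable fun ω => χ₂ (min (age (fun n => τ n ω) t) d) *
        ‖(lam * age (fun n => τ n ω) s) ^ p‖ₑ *
        (‖σ (lastIdx (fun n => τ n ω) s) ω‖ₑ * ‖σ (lastIdx (fun n => τ n ω) t) ω‖ₑ) := by
      have hσ : ∀ r, Measurable fun ω => σ (lastIdx (fun n => τ n ω) r) ω := fun r =>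
        measurable_apply_nat ((measurable_lastIdx_left r).comp hN.poisson.measurable_path)
          hN.measurable_σ
      exact ((mχ₂.comp mBω).mul (by fun_prop)).mul ((hσ s).enorm.mul (hσ t).enorm)
    have hsum := lintegral_add_right (μ := P) (fun ω => χ₁ (min (age (fun n => τ n ω) t) d) *
        (‖(lam * age (fun n => τ n ω) s) ^ p‖ₑ * ‖(lam * age (fun n => τ n ω) s + lam * d) ^ p‖ₑ)
        * ‖σ (lastIdx (fun n => τ n ω) s) ω‖ₑ ^ 2) hmeas₂
    have hfinal : ∫⁻ ω, volatility D lam τ σ s ω * volatility D lam τ σ t ω ∂P = _ :=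
      (lintegral_congr_ae ?_).trans (hsum.trans (congrArg₂ (· + ·) h1 h2))
    · rw [hfinal]
      ring
    · filter_upwards [hN.poisson.ae_isRegular] with ω hω
      unfold volatility
      rcases le_or_gt d (age (fun n => τ n ω) t) with h | h
      · have he := hω.lastIdx_eq_of_le_age hst.le h
        have : lam * age (fun n => τ n ω) t = lam * age (fun n => τ n ω) s + lam * d := by
          simp only [age, he, hd]
          ring
        simp only [hχ₁, hχ₂, h, this, he, min_eq_right, Set.indicator_of_mem, Set.mem_Ici,
          le_refl, Set.mem_Iio, lt_irrefl, not_false_eq_true, Set.indicator_of_notMem,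
          Pi.one_apply, ← hp]
        ring
      · have hnm : age (fun n => τ n ω) t ∉ Set.Ici d := by simpa using h
        simp only [hχ₁, hχ₂, min_eq_left h.le, Set.indicator_of_mem (Set.mem_Iio.2 h),
          Set.indicator_of_notMem hnm, ← hp]
        ring

end IsNoise

end VolModel

end

/-! ### The covariance of absolute increments and its limit -/

noncomputable section

namespace VolModel

variable {Ω : Type*} [MeasurableSpace Ω] {P : Measure Ω} [IsProbabilityMeasure P]
  {D lam : ℝ} {ν : Measure ℝ} {W : ℝ≥0 → Ω → ℝ} {τ : ℤ → Ω → ℝ} {σ : ℕ → Ω → ℝ}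

/-- The time change evaluated along the noise. -/
def pathClock (D : ℝ) (τ : ℤ → Ω → ℝ) (σ : ℕ → Ω → ℝ) (t : ℝ) (ω : Ω) : ℝ :=
  clock D (noisePath τ σ ω).1 (noisePath τ σ ω).2 t

/-- The derivative of the time change evaluated along the noise. -/
def pathRate (D : ℝ) (τ : ℤ → Ω → ℝ) (σ : ℕ → Ω → ℝ) (t : ℝ) (ω : Ω) : ℝ :=
  clockRate D (noisePath τ σ ω).1 (noisePath τ σ ω).2 t

/-- The square root of the difference quotient of the time change. -/
def sqrtSlope (D : ℝ) (τ : ℤ → Ω → ℝ) (σ : ℕ → Ω → ℝ) (t h : ℝ) (ω : Ω) : ℝ≥0∞ :=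
  ENNReal.ofReal √((pathClock D τ σ (t + h) ω - pathClock D τ σ t ω) / h)

/-- The cancellation behind the factor `e^{-x}`: substituting `κ = α - e β` makes `m₁² α²`
disappear. Finiteness permits the subtraction. -/
lemma toReal_decomposition {m₁ m₂ α β γ κ e : ℝ≥0∞} (hm₁ : m₁ ≠ ∞) (hm₂ : m₂ ≠ ∞) (hα : α ≠ ∞)
    (hβ : β ≠ ∞) (hγ : γ ≠ ∞) (he : e ≠ ∞) (h : α = e * β + κ) :
    (e * (m₂ * γ) + m₁ ^ 2 * α * κ).toReal - (m₁ * α).toReal * (m₁ * α).toReal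
      = e.toReal * ((m₂ * γ).toReal - (m₁ * α).toReal * (m₁ * β).toReal) := by
  have hκ : κ ≠ ∞ := ne_top_of_le_ne_top hα (h ▸ le_add_self)
  lift m₁ to ℝ≥0 using hm₁
  lift m₂ to ℝ≥0 using hm₂
  lift α to ℝ≥0 using hα
  lift β to ℝ≥0 using hβ
  lift γ to ℝ≥0 using hγ
  lift κ to ℝ≥0 using hκ
  lift e to ℝ≥0 using he
  have h' : (α : ℝ) = e * β + κ := by exact_mod_cast h
  simp only [← ENNReal.coe_mul, ← ENNReal.coe_add, ← ENNReal.coe_pow, ENNReal.coe_toReal]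
  push_cast
  rw [h']
  ring

namespace IsNoise

variable (hN : IsNoise lam ν W τ σ P)
include hN

omit [IsProbabilityMeasure P] in
lemma measurable_pathClock (t : ℝ) : Measurable (pathClock D τ σ t) :=
  (measurable_clock D t).comp hN.measurable_noisePath

omit [IsProbabilityMeasure P] in
lemma measurable_pathRate (t : ℝ) : Measurable (pathRate D τ σ t) :=
  (measurable_clockRate D).comp (hN.measurable_noisePath.prodMk measurable_const)

omit [IsProbabilityMeasure P] in
lemma measurable_sqrtSlope (t h : ℝ) : Measurable (sqrtSlope D τ σ t h) := by
  have h1 := hN.measurable_pathClock (D := D) t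
  have h2 := hN.measurable_pathClock (D := D) (t + h)
  unfold sqrtSlope
  fun_prop

omit [IsProbabilityMeasure P] in
lemma aemeasurable_process (t : ℝ) : AEMeasurable (process D W τ σ t) P :=
  aemeasurable_apply_randomTime hN.measurable_W hN.brownian.cont hN.measurable_noisePath
    (measurable_clock D t).real_toNNReal

omit [IsProbabilityMeasure P] in
lemma ae_pathClock_nonneg (hD₀ : 0 < D) {t : ℝ} (ht : 0 ≤ t) :
    ∀ᵐ ω ∂P, 0 ≤ pathClock D τ σ t ω := by
  filter_upwards [hN.poisson.ae_isRegular] with ω hω using clock_nonneg hD₀ hω _ ht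

omit [IsProbabilityMeasure P] in
lemma ae_pathClock_mono (hD₀ : 0 < D) {s t : ℝ} (hs : 0 ≤ s) (hst : s ≤ t) :
    ∀ᵐ ω ∂P, pathClock D τ σ s ω ≤ pathClock D τ σ t ω := by
  filter_upwards [hN.poisson.ae_isRegular] with ω hω using clock_mono hD₀ hω _ hs hst

/-- Conditioning on the noise: `timeChange` unfolds to `pathClock`, a function of `τ` and `σ`, which
are independent of `W`. -/
lemma lintegral_process {ι : Type*} (r : ι → ℝ) {G : (ι → ℝ) → ℝ≥0∞} (hG : Measurable G) :
    ∫⁻ ω, G (fun i => process D W τ σ (r i) ω) ∂P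
      = ∫⁻ ω, ∫⁻ ω', G (fun i => W (pathClock D τ σ (r i) ω).toNNReal ω') ∂P ∂P :=
  lintegral_apply_randomTimes hN.measurable_W hN.brownian.cont hN.measurable_noisePath
    hN.indep_W (fun i => (measurable_clock D (r i)).real_toNNReal) hG

lemma lintegral_enorm_sub_sq (hD₀ : 0 < D) {s t : ℝ} (hs : 0 ≤ s) (hst : s ≤ t) :
    ∫⁻ ω, ‖process D W τ σ t ω - process D W τ σ s ω‖ₑ ^ 2 ∂P
      = ∫⁻ ω, ENNReal.ofReal (pathClock D τ σ t ω - pathClock D τ σ s ω) ∂P := by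
  have h := hN.lintegral_process (D := D) ![s, t]
    (G := fun v => ‖v 1 - v 0‖ₑ ^ 2) (by fun_prop)
  simp only [Matrix.cons_val_zero, Matrix.cons_val_one] at h
  rw [h]
  refine lintegral_congr_ae ?_
  filter_upwards [hN.ae_pathClock_nonneg hD₀ hs, hN.ae_pathClock_mono hD₀ hs hst] with ω h1 h2
  rw [lintegral_enorm_increment_sq hN.brownian.toIsPreBrownianReal (Real.toNNReal_le_toNNReal h2),
    Real.coe_toNNReal _ h1, Real.coe_toNNReal _ (h1.trans h2)]

lemma lintegral_enorm_sub (hD₀ : 0 < D) {s t : ℝ} (hs : 0 ≤ s) (hst : s ≤ t) :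
    ∫⁻ ω, ‖process D W τ σ t ω - process D W τ σ s ω‖ₑ ∂P
      = ∫⁻ ω, ENNReal.ofReal
          (√(2 / Real.pi) * √(pathClock D τ σ t ω - pathClock D τ σ s ω)) ∂P := by
  have h := hN.lintegral_process (D := D) ![s, t] (G := fun v => ‖v 1 - v 0‖ₑ) (by fun_prop)
  simp only [Matrix.cons_val_zero, Matrix.cons_val_one] at h
  rw [h]
  refine lintegral_congr_ae ?_
  filter_upwards [hN.ae_pathClock_nonneg hD₀ hs, hN.ae_pathClock_mono hD₀ hs hst] with ω h1 h2
  rw [lintegral_enorm_increment hN.brownian.toIsPreBrownianReal (Real.toNNReal_le_toNNReal h2),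
    Real.coe_toNNReal _ h1, Real.coe_toNNReal _ (h1.trans h2)]

lemma lintegral_enorm_sub_mul (hD₀ : 0 < D) {a b c d : ℝ} (ha : 0 ≤ a) (hab : a ≤ b)
    (hbc : b ≤ c) (hcd : c ≤ d) :
    ∫⁻ ω, ‖process D W τ σ b ω - process D W τ σ a ω‖ₑ *
        ‖process D W τ σ d ω - process D W τ σ c ω‖ₑ ∂P
      = ∫⁻ ω, ENNReal.ofReal (2 / Real.pi * (√(pathClock D τ σ b ω - pathClock D τ σ a ω) *
          √(pathClock D τ σ d ω - pathClock D τ σ c ω))) ∂P := by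
  have h := hN.lintegral_process (D := D) ![a, b, c, d]
    (G := fun v => ‖v 1 - v 0‖ₑ * ‖v 3 - v 2‖ₑ) (by fun_prop)
  simp only [Matrix.cons_val_zero, Matrix.cons_val_one, Matrix.cons_val] at h
  rw [h]
  refine lintegral_congr_ae ?_
  filter_upwards [hN.ae_pathClock_nonneg hD₀ ha, hN.ae_pathClock_mono hD₀ ha hab,
    hN.ae_pathClock_mono hD₀ (ha.trans hab) hbc,
    hN.ae_pathClock_mono hD₀ ((ha.trans hab).trans hbc) hcd] with ω h1 h2 h3 h4
  rw [lintegral_enorm_increment_mul hN.brownian.toIsPreBrownianReal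
    (Real.toNNReal_le_toNNReal h2) (Real.toNNReal_le_toNNReal h3) (Real.toNNReal_le_toNNReal h4),
    Real.coe_toNNReal _ h1, Real.coe_toNNReal _ (h1.trans h2),
    Real.coe_toNNReal _ ((h1.trans h2).trans h3),
    Real.coe_toNNReal _ (((h1.trans h2).trans h3).trans h4)]

lemma memLp_process_sub (hD₀ : 0 < D) (hlam : 0 < lam)
    (hν₂ : Integrable (fun x : ℝ => x ^ 2) ν) {s t : ℝ} (hs : 0 ≤ s) (ht : 0 ≤ t) :
    MemLp (fun ω => process D W τ σ t ω - process D W τ σ s ω) 2 P := by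
  wlog hst : s ≤ t generalizing s t
  · refine (this ht hs (le_of_not_ge hst)).neg.congr_norm
      ((hN.aemeasurable_process t).sub (hN.aemeasurable_process s)).aestronglyMeasurable
      (Eventually.of_forall fun ω => ?_)
    simp only [Pi.neg_apply, neg_sub]
  refine memLp_two_of_lintegral_enorm_sq
    ((hN.aemeasurable_process t).sub (hN.aemeasurable_process s)) ?_
  rw [hN.lintegral_enorm_sub_sq hD₀ hs hst]
  exact (hN.lintegral_clock_sub hD₀ hlam hs hst).trans_ne
    (ENNReal.mul_ne_top ENNReal.ofReal_ne_top (hN.lintegral_clockRate_ne_top hD₀ hlam hν₂ hs))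

lemma ae_age_pos (hlam : 0 < lam) {t : ℝ} (ht : 0 ≤ t) :
    ∀ᵐ ω ∂P, 0 < age (fun n => τ n ω) t := by
  have h := ae_expMeasure_one_pos
  rw [← hN.poisson.map_age hlam ht] at h
  have h2 := ae_of_ae_map (((measurable_age_left t).comp
    hN.poisson.measurable_path).const_mul lam).aemeasurable h
  filter_upwards [h2] with ω hω using pos_of_mul_pos_right hω hlam.le

lemma ae_tendsto_slope (hlam : 0 < lam) {t : ℝ} (ht : 0 ≤ t) :
    ∀ᵐ ω ∂P, Tendsto (fun h => (pathClock D τ σ (t + h) ω - pathClock D τ σ t ω) / h) (𝓝[>] 0)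
      (𝓝 (pathRate D τ σ t ω)) := by
  filter_upwards [hN.ae_age_pos hlam ht, hN.poisson.ae_isRegular] with ω h1 h2
  exact tendsto_clock_slope h2 _ ht h1

/-- Stationarity makes the mean difference quotient independent of `h`; this supplies the
convergence of the dominating integrals below. -/
lemma lintegral_slope (hD₀ : 0 < D) (hlam : 0 < lam) {t h : ℝ} (ht : 0 ≤ t) (hh : 0 < h) :
    ∫⁻ ω, ENNReal.ofReal ((pathClock D τ σ (t + h) ω - pathClock D τ σ t ω) / h) ∂P
      = ∫⁻ ω, ENNReal.ofReal (pathRate D τ σ t ω) ∂P := by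
  have h1 := hN.lintegral_clock_sub hD₀ hlam ht (le_add_of_nonneg_right hh.le : t ≤ t + h)
  simp_rw [div_eq_inv_mul, ENNReal.ofReal_mul (inv_nonneg.2 hh.le)]
  rw [lintegral_const_mul' _ _ ENNReal.ofReal_ne_top]
  refine (congrArg _ h1).trans ?_
  rw [← mul_assoc, ← ENNReal.ofReal_mul (inv_nonneg.2 hh.le), add_sub_cancel_left,
    inv_mul_cancel₀ hh.ne', ENNReal.ofReal_one, one_mul]
  rfl

lemma tendsto_lintegral_sqrtSlope (hD₀ : 0 < D) (hlam : 0 < lam)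
    (hν₂ : Integrable (fun x : ℝ => x ^ 2) ν) {t : ℝ} (ht : 0 ≤ t) :
    Tendsto (fun h => ∫⁻ ω, sqrtSlope D τ σ t h ω ∂P) (𝓝[>] 0)
      (𝓝 (∫⁻ ω, ENNReal.ofReal √(pathRate D τ σ t ω) ∂P)) := by
  have hm := fun r => hN.measurable_pathClock (D := D) r
  have hr := hN.measurable_pathRate (D := D) t
  have hle : ∀ x : ℝ, ENNReal.ofReal √x ≤ 1 + ENNReal.ofReal x := by
    intro x
    rcases le_total x 0 with hx | hx
    · simp [Real.sqrt_eq_zero_of_nonpos hx]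
    · rw [← ENNReal.ofReal_one, ← ENNReal.ofReal_add zero_le_one hx]
      refine ENNReal.ofReal_le_ofReal ?_
      nlinarith [Real.sq_sqrt hx, sq_nonneg (√x - 1), Real.sqrt_nonneg x]
  refine tendsto_lintegral_of_tendsto_bound
    (g := fun h ω => 1 + ENNReal.ofReal ((pathClock D τ σ (t + h) ω - pathClock D τ σ t ω) / h))
    (g₀ := fun ω => 1 + ENNReal.ofReal (pathRate D τ σ t ω)) ?_ ?_ ?_ ?_ ?_ ?_ ?_ ?_ ?_
  · exact Eventually.of_forall fun h => (hN.measurable_sqrtSlope t h).aemeasurable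
  · exact Eventually.of_forall fun h => by fun_prop
  · fun_prop
  · exact Eventually.of_forall fun h => Eventually.of_forall fun ω => hle _
  · filter_upwards [hN.ae_tendsto_slope (D := D) hlam ht] with ω h
    exact ENNReal.tendsto_ofReal h.sqrt
  · filter_upwards [hN.ae_tendsto_slope (D := D) hlam ht] with ω h
    exact (ENNReal.tendsto_ofReal h).const_add 1
  · exact Eventually.of_forall fun ω => hle _
  · refine tendsto_const_nhds.congr' ?_
    filter_upwards [self_mem_nhdsWithin] with h hh
    rw [lintegral_add_left measurable_const, lintegral_add_left measurable_const,
      hN.lintegral_slope hD₀ hlam ht hh]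
  · rw [lintegral_add_left measurable_const]
    exact ENNReal.add_ne_top.2 ⟨by simp, hN.lintegral_clockRate_ne_top hD₀ hlam hν₂ ht⟩

lemma tendsto_lintegral_sqrtSlope_mul (hD₀ : 0 < D) (hlam : 0 < lam)
    (hν₂ : Integrable (fun x : ℝ => x ^ 2) ν) {s t : ℝ} (hs : 0 ≤ s) (ht : 0 ≤ t) :
    Tendsto (fun h => ∫⁻ ω, sqrtSlope D τ σ s h ω * sqrtSlope D τ σ t h ω ∂P) (𝓝[>] 0)
      (𝓝 (∫⁻ ω, ENNReal.ofReal √(pathRate D τ σ s ω) *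
        ENNReal.ofReal √(pathRate D τ σ t ω) ∂P)) := by
  have hm := fun r => hN.measurable_pathClock (D := D) r
  have hr := fun r => hN.measurable_pathRate (D := D) r
  have hsq : ∀ x : ℝ, ENNReal.ofReal √x * ENNReal.ofReal √x = ENNReal.ofReal x := by
    intro x
    rcases le_total x 0 with hx | hx
    · simp [Real.sqrt_eq_zero_of_nonpos hx, ENNReal.ofReal_of_nonpos hx]
    · rw [← ENNReal.ofReal_mul (Real.sqrt_nonneg x), Real.mul_self_sqrt hx]
  -- The product is at most the larger of the two squares, hence at most their sum.
  have hle : ∀ x y : ℝ, ENNReal.ofReal √x * ENNReal.ofReal √y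
      ≤ ENNReal.ofReal x + ENNReal.ofReal y := by
    intro x y
    rcases le_total (ENNReal.ofReal √x) (ENNReal.ofReal √y) with h | h
    · exact (mul_le_mul_left h _).trans ((hsq y).le.trans le_add_self)
    · exact (mul_le_mul_right h _).trans ((hsq x).le.trans le_self_add)
  refine tendsto_lintegral_of_tendsto_bound
    (g := fun h ω => ENNReal.ofReal ((pathClock D τ σ (s + h) ω - pathClock D τ σ s ω) / h)
      + ENNReal.ofReal ((pathClock D τ σ (t + h) ω - pathClock D τ σ t ω) / h))
    (g₀ := fun ω => ENNReal.ofReal (pathRate D τ σ s ω) + ENNReal.ofReal (pathRate D τ σ t ω))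
    ?_ ?_ ?_ ?_ ?_ ?_ ?_ ?_ ?_
  · exact Eventually.of_forall fun h =>
      ((hN.measurable_sqrtSlope s h).mul (hN.measurable_sqrtSlope t h)).aemeasurable
  · exact Eventually.of_forall fun h => by fun_prop
  · fun_prop
  · exact Eventually.of_forall fun h => Eventually.of_forall fun ω => hle _ _
  · filter_upwards [hN.ae_tendsto_slope (D := D) hlam hs,
      hN.ae_tendsto_slope (D := D) hlam ht] with ω h h'
    exact ENNReal.Tendsto.mul (ENNReal.tendsto_ofReal h.sqrt) (Or.inr ENNReal.ofReal_ne_top)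
      (ENNReal.tendsto_ofReal h'.sqrt) (Or.inr ENNReal.ofReal_ne_top)
  · filter_upwards [hN.ae_tendsto_slope (D := D) hlam hs,
      hN.ae_tendsto_slope (D := D) hlam ht] with ω h h'
    exact (ENNReal.tendsto_ofReal h).add (ENNReal.tendsto_ofReal h')
  · exact Eventually.of_forall fun ω => hle _ _
  · refine tendsto_const_nhds.congr' ?_
    filter_upwards [self_mem_nhdsWithin] with h hh
    rw [lintegral_add_left (by fun_prop), lintegral_add_left (by fun_prop),
      hN.lintegral_slope hD₀ hlam hs hh, hN.lintegral_slope hD₀ hlam ht hh]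
  · rw [lintegral_add_left (by fun_prop)]
    exact ENNReal.add_ne_top.2 ⟨hN.lintegral_clockRate_ne_top hD₀ hlam hν₂ hs,
      hN.lintegral_clockRate_ne_top hD₀ hlam hν₂ ht⟩

-- The factor `lam ^ (1 / 2 - D)` compensates the rescaling of the age by `lam`, which turns it into
-- a standard exponential variable.
omit [IsProbabilityMeasure P] in
lemma ae_ofReal_sqrt_pathRate (hD₀ : 0 < D) (hlam : 0 < lam) {t : ℝ} (ht : 0 ≤ t) :
    ∀ᵐ ω ∂P, ENNReal.ofReal √(pathRate D τ σ t ω)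
      = ENNReal.ofReal (√(2 * D) * lam ^ (1 / 2 - D)) * volatility D lam τ σ t ω := by
  filter_upwards [hN.poisson.ae_isRegular] with ω hω
  have hage := hω.age_nonneg ht
  have h1 : 0 ≤ (lam * age (fun n => τ n ω) t) ^ (D - 1 / 2) := by positivity
  unfold volatility
  rw [Real.enorm_eq_ofReal h1, Real.enorm_eq_ofReal_abs, ← ENNReal.ofReal_mul h1,
    ← ENNReal.ofReal_mul (by positivity)]
  congr 1
  simp only [pathRate, clockRate, noisePath]
  have hl : lam ^ (1 / 2 - D) * lam ^ (D - 1 / 2) = 1 := by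
    rw [← Real.rpow_add hlam]
    simp
  rw [Real.sqrt_mul (sq_nonneg _), Real.sqrt_mul (by positivity), Real.sqrt_sq_eq_abs,
    ← rpow_sub_half_sq hage, Real.sqrt_sq (by positivity), Real.mul_rpow hlam.le hage]
  linear_combination (-(√(2 * D) * age (fun n => τ n ω) t ^ (D - 1 / 2) *
    |σ (lastIdx (fun n => τ n ω) t) ω|)) * hl

/-- As `s + h ≤ t`, the increments use disjoint stretches of Brownian time. Each absolute increment
contributes `√(2/π) √h`, so the mean of the product and the product of the means carry the same
factor `2h/π`. -/
lemma covariance_abs_sub_div (hD₀ : 0 < D) (hlam : 0 < lam)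
    (hν₂ : Integrable (fun x : ℝ => x ^ 2) ν) {s t h : ℝ} (hs : 0 ≤ s) (hh : 0 < h)
    (hst : s + h ≤ t) :
    covariance (fun ω => |process D W τ σ (s + h) ω - process D W τ σ s ω|)
        (fun ω => |process D W τ σ (t + h) ω - process D W τ σ t ω|) P / h
      = 2 / Real.pi * ((∫⁻ ω, sqrtSlope D τ σ s h ω * sqrtSlope D τ σ t h ω ∂P).toReal
        - (∫⁻ ω, sqrtSlope D τ σ s h ω ∂P).toReal *
          (∫⁻ ω, sqrtSlope D τ σ t h ω ∂P).toReal) := by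
  have ht : 0 ≤ t := by linarith
  have hπ := Real.pi_pos
  have hsq : ∀ r ω, √(pathClock D τ σ (r + h) ω - pathClock D τ σ r ω)
      = √h * √((pathClock D τ σ (r + h) ω - pathClock D τ σ r ω) / h) := by
    intro r ω
    rw [← Real.sqrt_mul hh.le]
    congr 1
    field_simp
  have hone : ∀ r, 0 ≤ r → ∫⁻ ω, ‖process D W τ σ (r + h) ω - process D W τ σ r ω‖ₑ ∂P
      = ENNReal.ofReal (√(2 / Real.pi) * √h) * ∫⁻ ω, sqrtSlope D τ σ r h ω ∂P := by
    intro r hr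
    rw [hN.lintegral_enorm_sub hD₀ hr (by linarith),
      ← lintegral_const_mul' _ _ ENNReal.ofReal_ne_top]
    refine lintegral_congr fun ω => ?_
    rw [hsq, ← mul_assoc, ENNReal.ofReal_mul (by positivity)]
    rfl
  have htwo : ∫⁻ ω, ‖process D W τ σ (s + h) ω - process D W τ σ s ω‖ₑ *
        ‖process D W τ σ (t + h) ω - process D W τ σ t ω‖ₑ ∂P
      = ENNReal.ofReal (2 / Real.pi * h) *
        ∫⁻ ω, sqrtSlope D τ σ s h ω * sqrtSlope D τ σ t h ω ∂P := by
    rw [hN.lintegral_enorm_sub_mul hD₀ hs (by linarith) hst (by linarith),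
      ← lintegral_const_mul' _ _ ENNReal.ofReal_ne_top]
    refine lintegral_congr fun ω => ?_
    simp only [sqrtSlope]
    rw [← ENNReal.ofReal_mul (by positivity), ← ENNReal.ofReal_mul (by positivity), hsq, hsq]
    congr 1
    linear_combination (2 / Real.pi * (√((pathClock D τ σ (s + h) ω - pathClock D τ σ s ω) / h) *
      √((pathClock D τ σ (t + h) ω - pathClock D τ σ t ω) / h))) * Real.mul_self_sqrt hh.le
  have habs : ∀ r, 0 ≤ r →
      MemLp (fun ω => |process D W τ σ (r + h) ω - process D W τ σ r ω|) 2 P := fun r hr =>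
    (hN.memLp_process_sub hD₀ hlam hν₂ hr (by linarith)).abs
  rw [covariance_eq_lintegral (habs s hs) (habs t ht)
    (Eventually.of_forall fun _ => abs_nonneg _) (Eventually.of_forall fun _ => abs_nonneg _)]
  have enorm_abs : ∀ x : ℝ, ‖|x|‖ₑ = ‖x‖ₑ := fun x => by simp [Real.enorm_eq_ofReal_abs]
  simp only [enorm_abs]
  rw [hone s hs, hone t ht, htwo, ENNReal.toReal_mul, ENNReal.toReal_mul, ENNReal.toReal_mul,
    ENNReal.toReal_ofReal (by positivity), ENNReal.toReal_ofReal (by positivity)]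
  have h2 : √(2 / Real.pi) * √(2 / Real.pi) = 2 / Real.pi := Real.mul_self_sqrt (by positivity)
  have h3 : √h * √h = h := Real.mul_self_sqrt hh.le
  rw [div_eq_iff hh.ne']
  set A := (∫⁻ ω, sqrtSlope D τ σ s h ω ∂P).toReal
  set B := (∫⁻ ω, sqrtSlope D τ σ t h ω ∂P).toReal
  linear_combination (-(A * B) * (√h * √h)) * h2 - (A * B * (2 / Real.pi)) * h3

lemma tendsto_covariance_div [IsProbabilityMeasure ν] (hν : ∀ᵐ x ∂ν, 0 < x)
    (hD₀ : 0 < D) (hD₁ : D ≤ 1 / 2) (hlam : 0 < lam)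
    (hν₂ : Integrable (fun x : ℝ => x ^ 2) ν) {s t : ℝ} (hs : 0 ≤ s) (hst : s < t) :
    Tendsto (fun h => covariance (fun ω => |process D W τ σ (s + h) ω - process D W τ σ s ω|)
        (fun ω => |process D W τ σ (t + h) ω - process D W τ σ t ω|) P / h) (𝓝[>] 0)
      (𝓝 (4 * D / Real.pi * lam ^ (1 - 2 * D) * Real.exp (-(lam * (t - s))) *
        phi D ν (lam * (t - s)))) := by
  have ht : 0 ≤ t := hs.trans hst.le
  have hx : 0 ≤ lam * (t - s) := mul_nonneg hlam.le (sub_nonneg.2 hst.le)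
  -- The ratio of `√I'` to the volatility; `2/π * C²` is the constant `4D/π * lam ^ (1 - 2D)` of the
  -- theorem.
  set C := √(2 * D) * lam ^ (1 / 2 - D) with hC
  have hC₀ : 0 ≤ C := by positivity
  have hC₂ : C * C = 2 * D * lam ^ (1 - 2 * D) := by
    have h1 : √(2 * D) * √(2 * D) = 2 * D := Real.mul_self_sqrt (by positivity)
    have h2 : lam ^ (1 / 2 - D) * lam ^ (1 / 2 - D) = lam ^ (1 - 2 * D) := by
      rw [← Real.rpow_add hlam]
      ring_nf
    rw [hC, ← h2]
    linear_combination (lam ^ (1 / 2 - D) * lam ^ (1 / 2 - D)) * h1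
  have hone : ∀ r, 0 ≤ r → ∫⁻ ω, ENNReal.ofReal √(pathRate D τ σ r ω) ∂P
      = ENNReal.ofReal C * ∫⁻ ω, volatility D lam τ σ r ω ∂P := by
    intro r hr
    rw [← lintegral_const_mul' _ _ ENNReal.ofReal_ne_top]
    exact lintegral_congr_ae (hN.ae_ofReal_sqrt_pathRate hD₀ hlam hr)
  have htwo : ∫⁻ ω, ENNReal.ofReal √(pathRate D τ σ s ω) *
        ENNReal.ofReal √(pathRate D τ σ t ω) ∂P
      = ENNReal.ofReal (C * C) *
        ∫⁻ ω, volatility D lam τ σ s ω * volatility D lam τ σ t ω ∂P := by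
    rw [← lintegral_const_mul' _ _ ENNReal.ofReal_ne_top]
    refine lintegral_congr_ae ?_
    filter_upwards [hN.ae_ofReal_sqrt_pathRate hD₀ hlam hs,
      hN.ae_ofReal_sqrt_pathRate hD₀ hlam ht] with ω h1 h2
    rw [h1, h2, ENNReal.ofReal_mul hC₀]
    ring
  have hL := memLp_rpow_add hD₀ hD₁ le_rfl
  simp only [add_zero] at hL
  have hLx := memLp_rpow_add hD₀ hD₁ hx
  have hσ₂ : MemLp (fun y : ℝ => y) 2 ν := (memLp_two_iff_integrable_sq (by fun_prop)).2 hν₂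
  have hm₁ : ∫⁻ y, ‖y‖ₑ ∂ν ≠ ∞ := (hσ₂.integrable one_le_two).2.ne
  have hm₂ : ∫⁻ y, ‖y‖ₑ ^ 2 ∂ν ≠ ∞ := by simpa only [← enorm_pow] using hν₂.2.ne
  have hα := (hL.integrable one_le_two).2.ne
  have hβ := (hLx.integrable one_le_two).2.ne
  have hγ : ∫⁻ u, ‖u ^ (D - 1 / 2)‖ₑ * ‖(u + lam * (t - s)) ^ (D - 1 / 2)‖ₑ ∂(expMeasure 1)
      ≠ ∞ := by
    simpa only [← enorm_mul, Pi.mul_apply] using (hL.integrable_mul hLx).2.ne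
  obtain ⟨κ, hκ₁, hκ₂⟩ := hN.exists_lintegral_volatility_mul (D := D) hlam hs hst
  have hvs := hN.lintegral_volatility (D := D) hlam hs
  have hvt := hN.lintegral_volatility (D := D) hlam ht
  have hdec := toReal_decomposition hm₁ hm₂ hα hβ hγ ENNReal.ofReal_ne_top hκ₁
  rw [ENNReal.toReal_ofReal (Real.exp_pos _).le] at hdec
  rw [← phi_eq hν hν₂ hD₀ hD₁ hx, ← hκ₂] at hdec
  have hκ : κ ≠ ∞ := ne_top_of_le_ne_top hα (hκ₁ ▸ le_add_self)
  have hv_fin : ∀ r, 0 ≤ r → ∫⁻ ω, volatility D lam τ σ r ω ∂P ≠ ∞ := fun r hr => by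
    rw [hN.lintegral_volatility hlam hr]
    exact ENNReal.mul_ne_top hm₁ hα
  have hvv_fin : ∫⁻ ω, volatility D lam τ σ s ω * volatility D lam τ σ t ω ∂P ≠ ∞ := by
    rw [hκ₂]
    exact ENNReal.add_ne_top.2 ⟨ENNReal.mul_ne_top ENNReal.ofReal_ne_top
      (ENNReal.mul_ne_top hm₂ hγ), ENNReal.mul_ne_top (ENNReal.mul_ne_top
        (ENNReal.pow_ne_top hm₁) hα) hκ⟩
  have l₁ := fun r (hr : 0 ≤ r) => (ENNReal.tendsto_toReal (by
    rw [hone r hr]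
    exact ENNReal.mul_ne_top ENNReal.ofReal_ne_top (hv_fin r hr))).comp
      (hN.tendsto_lintegral_sqrtSlope hD₀ hlam hν₂ hr)
  have l₂ := (ENNReal.tendsto_toReal (by
    rw [htwo]
    exact ENNReal.mul_ne_top ENNReal.ofReal_ne_top hvv_fin)).comp
      (hN.tendsto_lintegral_sqrtSlope_mul hD₀ hlam hν₂ hs ht)
  have hlim := (l₂.sub ((l₁ s hs).mul (l₁ t ht))).const_mul (2 / Real.pi)
  rw [htwo, hone s hs, hone t ht, hvs, hvt] at hlim
  simp only [ENNReal.toReal_mul (a := ENNReal.ofReal _), ENNReal.toReal_ofReal hC₀,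
    ENNReal.toReal_ofReal (mul_nonneg hC₀ hC₀)] at hlim
  convert hlim.congr' ?_ using 2
  · linear_combination (-(2 / Real.pi) * (C * C)) * hdec -
      (2 / Real.pi) * (Real.exp (-(lam * (t - s))) * phi D ν (lam * (t - s))) * hC₂
  -- For `h < t - s` the two increments do not overlap.
  · filter_upwards [Ioo_mem_nhdsGT (sub_pos.2 hst)] with h hh
    exact (hN.covariance_abs_sub_div hD₀ hlam hν₂ hs hh.1 (by linarith [hh.2])).symm

end IsNoise

end VolModel

end

/-! ### The theorem: reduction to `s < t` and the little-o form -/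

theorem theorem4 {Ω : Type*} [MeasurableSpace Ω] (P : Measure Ω) [IsProbabilityMeasure P]
    (D lam : ℝ) (hD₀ : 0 < D) (hD₁ : D ≤ 1 / 2) (hlam : 0 < lam)
    (ν : Measure ℝ) [IsProbabilityMeasure ν] (hν : ∀ᵐ x ∂ν, 0 < x)
    (hν₂ : Integrable (fun x : ℝ => x ^ 2) ν)
    (W : ℝ≥0 → Ω → ℝ) (τ : ℤ → Ω → ℝ) (σ : ℕ → Ω → ℝ)
    (hN : VolModel.IsNoise lam ν W τ σ P) :
    -- the increments of the process are square integrable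
    (∀ s t : ℝ, 0 ≤ s → 0 ≤ t →
      MemLp (fun ω => VolModel.process D W τ σ t ω - VolModel.process D W τ σ s ω) 2 P) ∧
    -- the variables in the definition of `φ` are square integrable
    (∀ x : ℝ, 0 ≤ x →
      MemLp (fun p : ℝ × ℝ => p.1 * (p.2 + x) ^ (D - 1 / 2)) 2 (ν.prod (expMeasure 1))) ∧
    -- the asymptotics of the covariance
    ∀ s t : ℝ, 0 < s → 0 < t → s ≠ t →
      ∃ r : ℝ → ℝ, r =o[𝓝[>] 0] (fun h : ℝ => h) ∧
        ∀ h : ℝ, 0 < h →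
          covariance
            (fun ω => |VolModel.process D W τ σ (s + h) ω - VolModel.process D W τ σ s ω|)
            (fun ω => |VolModel.process D W τ σ (t + h) ω - VolModel.process D W τ σ t ω|) P
          = 4 * D / Real.pi * lam ^ (1 - 2 * D) * Real.exp (-lam * |t - s|) *
              (VolModel.phi D ν (lam * |t - s|) * h + r h) := by
  refine ⟨fun s t hs ht => hN.memLp_process_sub hD₀ hlam hν₂ hs ht,
    fun x hx => VolModel.memLp_mul_rpow_add hν₂ hD₀ hD₁ hx, fun s t hs ht hst => ?_⟩
  have hlim : Tendsto (fun h : ℝ => covariance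
      (fun ω => |VolModel.process D W τ σ (s + h) ω - VolModel.process D W τ σ s ω|)
      (fun ω => |VolModel.process D W τ σ (t + h) ω - VolModel.process D W τ σ t ω|) P / h)
      (𝓝[>] 0) (𝓝 (4 * D / Real.pi * lam ^ (1 - 2 * D) * Real.exp (-lam * |t - s|) *
        VolModel.phi D ν (lam * |t - s|))) := by
    rw [neg_mul]
    rcases lt_or_gt_of_ne hst with h | h
    · rw [abs_of_pos (sub_pos.2 h)]
      exact hN.tendsto_covariance_div hν hD₀ hD₁ hlam hν₂ hs.le h
    · rw [abs_sub_comm, abs_of_pos (sub_pos.2 h)]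
      simp_rw [covariance_comm (fun ω => |VolModel.process D W τ σ (s + _) ω - _|)]
      exact hN.tendsto_covariance_div hν hD₀ hD₁ hlam hν₂ ht.le h
  set C := 4 * D / Real.pi * lam ^ (1 - 2 * D) * Real.exp (-lam * |t - s|) with hC
  have hC₀ : C ≠ 0 := by
    have := Real.pi_pos
    positivity
  -- The remainder is obtained by solving the claimed identity for `r h`, which is possible since `C
  -- ≠ 0`.
  refine ⟨fun h => covariance
      (fun ω => |VolModel.process D W τ σ (s + h) ω - VolModel.process D W τ σ s ω|)
      (fun ω => |VolModel.process D W τ σ (t + h) ω - VolModel.process D W τ σ t ω|) P / C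
      - VolModel.phi D ν (lam * |t - s|) * h, ?_, fun h _ => by field_simp; ring⟩
  rw [isLittleO_iff_tendsto' (by
    filter_upwards [self_mem_nhdsWithin] with h hh h0 using absurd h0 (ne_of_gt hh))]
  have h2 := (hlim.div_const C).sub_const (VolModel.phi D ν (lam * |t - s|))
  rw [mul_div_cancel_left₀ _ hC₀, sub_self] at h2
  refine h2.congr' ?_
  filter_upwards [self_mem_nhdsWithin] with h hh
  have : h ≠ 0 := ne_of_gt hh
  field_simp
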